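/- **Setting.** Three parties choose among $m$ inputs each and output $\pm1$. A correlation tensor $\mathbf r=(r_{ijk})_{i,j,k\in\{0,1,\dots,m\}}$ collects all expectation values of products of outputs, where the index $0$ means that the party is left out (so marginals are included and $r_{000}=1$). The local polytope $\mathcal L_m$ is the convex hull of the $2^{3m}$ deterministic strategies $d_{ijk}=a_ib_jc_k$, with $a_i,b_j,c_k\in\{\pm1\}$ for $i,j,k\ge1$ and $a_0=b_0=c_0=1$. For a tensor $M$ of coefficients, $\langle M,\mathbf r\rangle=\sum_{ijk}M_{ijk}r_{ijk}$; the local bound of $M$ is the maximum of $\langle M,\cdot\rangle$ over all deterministic strategies. The inequality $\langle M,\mathbf r\rangle\le\ell$ is a facet of a polytope $P$ if it is valid on $P$ and the points of $P$ with equality form a nonempty face of dimension $\dim P-1$. For $v\in[0,1]$ let $\rho_v=v\,|\mathrm{GHZ}_3\rangle\langle\mathrm{GHZ}_3|+(1-v)\,\mathbb 1/8$, where $|\mathrm{GHZ}_3\rangle=(|000\rangle+|111\rangle)/\sqrt2$. Qubit observables $A_x,B_y,C_z$ (Hermitian, traceless, squaring to $\mathbb 1$), completed by $A_0=B_0=C_0=\mathbb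 1$, give the tensor $r_{ijk}=\mathrm{Tr}[(A_i\otimes B_j\otimes C_k)\rho_v]$. Let $v_c^{\mathrm{GHZ}_3}$ be the supremum of the $v\in[0,1]$ such that, for all $m$ and all choices of $m$ such observables per party, this tensor lies in $\mathcal L_m$. Let $\mathbf p_v$ be the tensor obtained for $m=16$ when each party uses the observables $\cos\frac{(x-1)\pi}{16}\,\sigma_X+\sin\frac{(x-1)\pi}{16}\,\sigma_Y$, $x=1,\dots,16$, and let $v_{16}^{\mathrm{GHZ}_3}$ be the supremum of the $v\in[0,1]$ with $\mathbf p_v\in\mathcal L_{16}$. Let $f:\mathbb Z\to\mathbb R$ be the function with $f(s+16)=-f(s)$, $f(-s)=f(s)$ and $$512\,\big(f(0),\dots,f(8)\big)=\Big(1,\tfrac{11960704}{9508049},-\tfrac{120}{137},\tfrac{15419776}{9508049},\tfrac23,-\tfrac{5453760}{9508049},-\tfrac{56}{137},-\tfrac{11459008}{9508049},0\Big),$$ and let $M^*_{xyz}=f(x+y+z-3)$ for $x,y,z\in\{1,\dots,16\}$, with all coefficients that involve an index $0$ equal to zero. Let $\mathcal L_{16}^{\mathrm{sym}}$ be the symmetrised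 local polytope: the set of the points of $\mathcal L_{16}$ whose marginals all vanish and whose three-party entries are $r_{xyz}=g(x+y+z-3)$ for some $g:\mathbb Z\to\mathbb R$ with $g(s+16)=-g(s)$ and $g(-s)=g(s)$. **Theorem.** 1. $$v_{16}^{\mathrm{GHZ}_3}=\Big(\tfrac12+\tfrac{\sqrt2}{3}-\tfrac{120\cos\frac\pi8+56\sin\frac\pi8}{137}+\tfrac{11960704\cos\frac\pi{16}-11459008\sin\frac\pi{16}}{9508049}+\tfrac{15419776\cos\frac{3\pi}{16}-5453760\sin\frac{3\pi}{16}}{9508049}\Big)^{-1},$$ and $|v_{16}^{\mathrm{GHZ}_3}-0.49160|<5\cdot10^{-6}$. 2. The threshold is exact: for $v\in[0,1]$, $\mathbf p_v\in\mathcal L_{16}$ if and only if $v\le v_{16}^{\mathrm{GHZ}_3}$. 3. The Bell inequality $\langle M^*,\mathbf r\rangle\le1$ has local bound exactly $1$, it satisfies $\langle M^*,\mathbf p_1\rangle=1/v_{16}^{\mathrm{GHZ}_3}$, and it is a facet of $\mathcal L_{16}^{\mathrm{sym}}$. 4. There is a Bell inequality $\langle M,\mathbf r\rangle\le1$ with $M_{000}=0$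 that is a facet of the local polytope $\mathcal L_{16}$, has local bound exactly $1$, satisfies $\langle M,\mathbf p_1\rangle=1/v_{16}^{\mathrm{GHZ}_3}$, and coincides with $M^*$ on $\mathcal L_{16}^{\mathrm{sym}}$. 5. $v_c^{\mathrm{GHZ}_3}\le v_{16}^{\mathrm{GHZ}_3}$. -/

import Mathlib

open scoped Kronecker

noncomputable section

namespace GHZBell

/-! ### Correlation tensors and the local polytope

Three parties, `m` inputs each, outputs `±1`.  In a correlation tensor the index `some x` of a party
means that its output for the input `x` enters the expectation value, and the index `none` means
that this party is left out, so that marginals are included.  The entry at `(none, none, none)` is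
the expectation value of the constant `1`. -/

/-- Tripartite correlation tensors (with marginals) for `m` inputs per party. -/
abbrev Tensor (m : ℕ) := Option (Fin m) → Option (Fin m) → Option (Fin m) → ℝ

/-- The outputs `±1` of one party, extended by `1` when the party is left out. -/
def response {m : ℕ} (a : Fin m → ℤˣ) : Option (Fin m) → ℝ
  | none => 1
  | some x => ((a x : ℤ) : ℝ)

/-- The correlation tensor of the deterministic strategy `(a, b, c)`. -/
def detStrategy {m : ℕ} (a b c : Fin m → ℤˣ) : Tensor m :=
  fun i j k => response a i * response b j * response c k

/-- The local polytope: the convex hull of all deterministic strategies. -/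
def localPolytope (m : ℕ) : Set (Tensor m) :=
  convexHull ℝ {d | ∃ a b c : Fin m → ℤˣ, d = detStrategy a b c}

/-- The value of the Bell expression with coefficients `M` on the tensor `r`. -/
def bellValue {m : ℕ} (M r : Tensor m) : ℝ :=
  ∑ i, ∑ j, ∑ k, M i j k * r i j k

/-- `ℓ` is the local bound of `M`: the maximum over all deterministic strategies. -/
def IsLocalBound {m : ℕ} (M : Tensor m) (ℓ : ℝ) : Prop :=
  IsGreatest {t | ∃ a b c : Fin m → ℤˣ, t = bellValue M (detStrategy a b c)} ℓ

/-- The inequality `bellValue M r ≤ ℓ` defines a facet of the polytope `P`: it is valid on `P`, and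
the face where it is tight is nonempty and has dimension `dim P - 1`. -/
def IsFacet {m : ℕ} (P : Set (Tensor m)) (M : Tensor m) (ℓ : ℝ) : Prop :=
  (∀ r ∈ P, bellValue M r ≤ ℓ) ∧
  {r | r ∈ P ∧ bellValue M r = ℓ}.Nonempty ∧
  Module.finrank ℝ (vectorSpan ℝ {r | r ∈ P ∧ bellValue M r = ℓ}) + 1 =
    Module.finrank ℝ (vectorSpan ℝ P)

/-- The tensors with the symmetries of the GHZ correlations for regular polygons: all marginals
vanish, and the three-party entries are `g (x + y + z)` for an even `g` that changes sign when its
argument is increased by `m`.  (Raising one input by `1` and lowering another by `1`, or negating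
all inputs, preserves the GHZ correlations, when the input `x + m` is read as the input `x` with
flipped output.) -/
def IsPolygonSymmetric {m : ℕ} (r : Tensor m) : Prop :=
  (∀ i j k, (i = none ∨ j = none ∨ k = none) → ¬ (i = none ∧ j = none ∧ k = none) →
    r i j k = 0) ∧
  ∃ g : ℤ → ℝ, (∀ s, g (s + m) = -g s) ∧ (∀ s, g (-s) = g s) ∧
    ∀ x y z : Fin m, r (some x) (some y) (some z) =
      g (((x : ℕ) : ℤ) + ((y : ℕ) : ℤ) + ((z : ℕ) : ℤ))

/-- The symmetrised local polytope: the points of the local polytope that have the symmetries of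
the GHZ correlations. -/
def symmetrizedLocalPolytope (m : ℕ) : Set (Tensor m) :=
  {r | r ∈ localPolytope m ∧ IsPolygonSymmetric r}

/-! ### Quantum correlations -/

/-- Operators on one qubit. -/
abbrev Qubit := Matrix (Fin 2) (Fin 2) ℂ

/-- Operators on three qubits. -/
abbrev ThreeQubit := Matrix (Fin 2 × Fin 2 × Fin 2) (Fin 2 × Fin 2 × Fin 2) ℂ

/-- Traceless dichotomic qubit observables (projective measurements). -/
def IsObservable (A : Qubit) : Prop :=
  A.IsHermitian ∧ A.trace = 0 ∧ A * A = 1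

/-- The observables of one party, extended by the identity when the party is left out. -/
def withIdentity {m : ℕ} (A : Fin m → Qubit) : Option (Fin m) → Qubit
  | none => 1
  | some x => A x

/-- The correlation tensor given by the Born rule. -/
def quantumTensor {m : ℕ} (ρ : ThreeQubit) (A B C : Fin m → Qubit) : Tensor m :=
  fun i j k => (((withIdentity A i ⊗ₖ (withIdentity B j ⊗ₖ withIdentity C k)) * ρ).trace).re

/-- The vector `(|000⟩ + |111⟩) / √2`. -/
def ghzVector : Fin 2 × Fin 2 × Fin 2 → ℂ :=
  ((Real.sqrt 2 : ℝ) : ℂ)⁻¹ • (Pi.single (0, 0, 0) 1 + Pi.single (1, 1, 1) 1)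

/-- The GHZ state mixed with white noise, with visibility `v`. -/
def ghzState (v : ℝ) : ThreeQubit :=
  (v : ℂ) • Matrix.vecMulVec ghzVector (star ghzVector) + (((1 - v) / 8 : ℝ) : ℂ) • 1

def pauliX : Qubit := !![0, 1; 1, 0]

def pauliY : Qubit := !![0, -Complex.I; Complex.I, 0]

/-- The `m` observables whose Bloch vectors are `(cos (x π / m), sin (x π / m), 0)`, for
`x = 0, …, m - 1`. -/
def polygonObservable (m : ℕ) (x : Fin m) : Qubit :=
  ((Real.cos ((x : ℕ) * Real.pi / m) : ℝ) : ℂ) • pauliX +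
    ((Real.sin ((x : ℕ) * Real.pi / m) : ℝ) : ℂ) • pauliY

/-- The correlations of the noisy GHZ state when each party uses the `m` polygon observables. -/
def polygonTensor (m : ℕ) (v : ℝ) : Tensor m :=
  quantumTensor (ghzState v) (polygonObservable m) (polygonObservable m) (polygonObservable m)

/-- The nonlocality threshold of the GHZ state for the `m` polygon observables on each party. -/
def polygonThreshold (m : ℕ) : ℝ :=
  sSup {v | 0 ≤ v ∧ v ≤ 1 ∧ polygonTensor m v ∈ localPolytope m}

/-- A three-qubit state is local under projective measurements if all correlations that arise from
finitely many projective measurements of each party lie in the local polytope. -/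
def IsLocalUnderProjective (ρ : ThreeQubit) : Prop :=
  ∀ (m : ℕ) (A B C : Fin m → Qubit), (∀ x, IsObservable (A x)) → (∀ x, IsObservable (B x)) →
    (∀ x, IsObservable (C x)) → quantumTensor ρ A B C ∈ localPolytope m

/-- The nonlocality threshold of the GHZ state under all projective measurements. -/
def ghzThreshold : ℝ :=
  sSup {v | 0 ≤ v ∧ v ≤ 1 ∧ IsLocalUnderProjective (ghzState v)}

/-! ### The Bell inequality for 16 inputs -/

/-- The numbers `512 f(0), …, 512 f(15)`; they satisfy `f(16 - s) = -f(s)` for `0 < s < 16`. -/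
def bellProfile : Fin 16 → ℝ :=
  ![1, 11960704 / 9508049, -120 / 137, 15419776 / 9508049,
    2 / 3, -5453760 / 9508049, -56 / 137, -11459008 / 9508049,
    0, 11459008 / 9508049, 56 / 137, 5453760 / 9508049,
    -2 / 3, -15419776 / 9508049, 120 / 137, -11960704 / 9508049]

/-- The coefficient `f(s)`, extended to all `s` by `f(s + 16) = -f(s)`. -/
def bellCoeff (s : ℕ) : ℝ :=
  (-1) ^ (s / 16) * bellProfile (Fin.ofNat 16 s) / 512

/-- The Bell expression `∑ f(x + y + z) ⟨a_x b_y c_z⟩`, which has no marginal terms. -/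
def ghzBell : Tensor 16
  | some x, some y, some z => bellCoeff ((x : ℕ) + (y : ℕ) + (z : ℕ))
  | _, _, _ => 0

end GHZBell

end

namespace GHZBell

/-! The polygon correlations are constant along `x + y + z`, so locality is decided in the space of
even functions on `ZMod 32` with `g (x + 16) = -g x`. Such a function is fixed by its values at `0,
…, 7`, so the space has dimension eight. Averaging a local strategy over rotations whose shifts sum
to zero, and over reflection, keeps it local and lands in this space (`symTensor_symProfile_mem`).

One strategy supplies everything. All parties answer with a square wave, delayed by ten steps for
the third party. Stretching it by the odd multipliers `1, 3, …, 15`, with some signs flipped, gives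
eight symmetrised local points that form a basis. The coefficients `f` are those of the functional
equal to 1 on all eight, so the Bell value of a symmetric tensor is the sum of its coordinates in
that basis (`bellValue_symTensor`). For the cosine, all coordinates are nonnegative
(`vertexWeight_cosProfile_nonneg`). Hence `polygonTensor 16 v` is a mixture of the eight points and
white noise as soon as `v * polygonValue ≤ 1`; the Bell inequality gives the converse.

The hard part is validity of the inequality on all `2 ^ 48` strategies (`triForm_le`). The best
third party turns the form into a sum of absolute values. Rotations act independently on the first
two parties, so each may be taken with least code in its orbit, below `2 ^ 14`, and swapping them
orders the two codes. What remains is evaluated by the kernel, all second codes below a power of two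
being treated at once inside one large natural number. The `pack` lemmas show that this arithmetic
acts fieldwise without carries.

Noise has Bell value 0 and the eight tight points span the symmetric space from it, which gives the
symmetric facet. For a facet of the full polytope, a valid functional is tilted while its tight
strategies stay tight, until these span (`exists_functional_maximal_tight`). It still equals 1 on
the eight points and 0 on noise, hence agrees with `ghzBell` on symmetric tensors. -/

/-! ### The search for the local bound, in packed arithmetic -/

/-- The Bell coefficients `f`, cleared of denominators and indexed by `ZMod 32`. -/
def profile (s : ZMod 32) : ℤ :=
  ([3907808139, 4915849344, -3422897640, 6337527936, 2605205426, -2241495360, -1597352232, -4709652288, 0, 4709652288, 1597352232, 2241495360, -2605205426, -6337527936, 3422897640, -4915849344, -3907808139, -4915849344, 3422897640, -6337527936, -2605205426, 2241495360, 1597352232, 4709652288, 0, -4709652288, -1597352232, -2241495360, 2605205426, 6337527936, -3422897640, 4915849344] : List ℤ).getD s.val 0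

/-- The numbers `profile s + 2 ^ 33` for `s < 80`, packed in fields of 48 bits. -/
def profilePack : ℕ :=
  117731529626690569964300511958857053109675118470631012056119209424980126914087006333433336659407332485640354451514719193949854620717638086841179609452250429651836689544494832033470198273058788337909510966468161760183785913286262734226530528272611877291292993338864587481064893454193903173140884951908900733166284545501248448903191846372269573293825805735057169757459806788997536148313504310078972599677762427722402754309027490553030222467182513862984430815307209218627554365770488101296933878164173980557106653398368521353601191570761239724766171082838163299277870527128584193100771689031112199454355767508301439288774651233776496025940180684319017229050983319677732999458785457775333526088307980163067165430090966691649623284498354498206653222774097657047715713866532975387974782706925747854179459071797950468108654813772751483457087718187047364539380211625831869259803821601935822440652237003087347264781197008605941668166025492092901067908618692544415821909794137109410787752097239575012621451026091717180611680997080628049994980761448065270682739869168973182162972290505864537972548848837224045140718438738020364594012227576035033821497028590201739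

/-- Sixteen fields of 48 bits that hold `1`. -/
def onesRow : ℕ :=
  5515652263102006894261970836870278906004198260133373620339057806204405991025592082397357651831018455752582815831839105374667340282784483416323588967332360733996034370753079306782623940502593127096998777101232625418241

/-- The code of the sequence with code `n`, rotated by one step. -/
def rotCode (n : ℕ) : ℕ := (n >>> 1) + ((1 - n % 2) <<< 15)

/-- Whether one of the first `t` rotations of `c` is smaller than `n`. -/
def hasSmallerRotation (n : ℕ) : ℕ → ℕ → Bool
  | 0, _ => false
  | t + 1, c => Nat.blt (rotCode c) n || hasSmallerRotation n t (rotCode c)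

/-- The convolution of the Bell coefficients with the first `t` entries of the sequence with
code `n`, packed in 48 fields. -/
def convPack (n : ℕ) : ℕ → ℕ
  | 0 => 0
  | x + 1 => convPack n x +
      (profilePack >>> (48 * (x + 16 * ((n >>> x) % 2)))) % (1 <<< 2304)

/-- Sixteen consecutive fields of `H`. -/
def row (H y : ℕ) : ℕ := (H >>> (48 * y)) % (1 <<< 768)

/-- `2 ^ k` fields of 768 bits that hold `1`. -/
def onesPack : ℕ → ℕ
  | 0 => 1
  | k + 1 => onesPack k + onesPack k <<< (768 * (1 <<< k))

/-- The sum of the last `t` of the first 16 rows. -/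
def tailPack (H : ℕ) : ℕ → ℕ
  | 0 => 0
  | t + 1 => tailPack H t + row H (15 - t)

/-- The sums over all sign choices for the first `k` rows, in `2 ^ k` fields of 768 bits. -/
def levelPack (H X : ℕ) : ℕ → ℕ
  | 0 => X
  | k + 1 => (levelPack H X k + row H k * onesPack k) +
      (levelPack H X k + row H (k + 16) * onesPack k) <<< (768 * (1 <<< k))

/-- Fieldwise distance to `2 ^ 41`. -/
def absPack (O X : ℕ) : ℕ :=
  2 * (X &&& (((X &&& (O <<< 41)) >>> 41) * 2199023255551)) + (O <<< 41) - X

/-- Add to each field the field that is `m` fields higher. -/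
def foldPack (m T : ℕ) : ℕ := T + T >>> (48 * m)

/-- Whether the lowest of every sixteen fields is at most the local bound. -/
def boundedPack (O T : ℕ) : Bool :=
  Nat.beq ((T + O * 68367946410495) &&& (O <<< 46)) 0

/-- Whether the Bell expression is at most the local bound when the first party uses the code `n`
and the second party one of the first `2 ^ k` codes. -/
def checkBound (n k : ℕ) : Bool :=
  boundedPack (onesPack k) (foldPack 1 (foldPack 2 (foldPack 4 (foldPack 8
    (absPack (onesPack k * onesRow)
      (levelPack (convPack n 16) (tailPack (convPack n 16) (16 - k)) k))))))

/-- `checkBound n k` for the least `k ≤ t` with `n < 2 ^ k`. -/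
def checkBoundFrom (n : ℕ) : ℕ → Bool
  | 0 => checkBound n 0
  | t + 1 => bif Nat.ble (1 <<< t) n then checkBound n (t + 1) else checkBoundFrom n t

/-- Whether `n` is not the least code among its rotations or passes the check. -/
def checkCode (n : ℕ) : Bool :=
  hasSmallerRotation n 31 n || checkBoundFrom n 14

/-- Whether all codes with leading bits `n` and `d` further bits pass the check. -/
def checkCodes : ℕ → ℕ → Bool
  | 0, n => checkCode n
  | d + 1, n => checkCodes d (2 * n) && checkCodes d (2 * n + 1)


/-! ### Fieldwise arithmetic on packed numbers -/

/-- The number whose digits in base `2 ^ w` are `v 0, …, v (n - 1)`. -/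
def pack (w n : ℕ) (v : ℕ → ℕ) : ℕ := ∑ i ∈ Finset.range n, v i * 2 ^ (w * i)

theorem pack_congr {w n : ℕ} {u v : ℕ → ℕ} (h : ∀ i < n, u i = v i) : pack w n u = pack w n v :=
  Finset.sum_congr rfl fun i hi => by rw [h i (Finset.mem_range.1 hi)]

theorem pack_succ (w n : ℕ) (v : ℕ → ℕ) :
    pack w (n + 1) v = pack w n v + v n * 2 ^ (w * n) :=
  Finset.sum_range_succ _ _

theorem pack_one (w : ℕ) (v : ℕ → ℕ) : pack w 1 v = v 0 := by
  rw [pack, Finset.sum_range_one, mul_zero, pow_zero, mul_one]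

theorem pack_lt {w n : ℕ} {v : ℕ → ℕ} (h : ∀ i < n, v i < 2 ^ w) : pack w n v < 2 ^ (w * n) := by
  induction n with
  | zero => simp [pack]
  | succ n ih =>
    have h1 := ih fun i hi => h i (by omega)
    have h2 := Nat.succ_le_of_lt (h n (by omega))
    have h3 := Nat.mul_le_mul_right (2 ^ (w * n)) h2
    rw [pack_succ, Nat.mul_add_one, pow_add]
    rw [Nat.succ_mul] at h3
    nlinarith

theorem pack_add_length (w m n : ℕ) (v : ℕ → ℕ) :
    pack w (m + n) v = 2 ^ (w * m) * pack w n (fun i => v (m + i)) + pack w m v := by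
  unfold pack
  rw [Finset.sum_range_add, Finset.mul_sum, add_comm]
  congr 1
  refine Finset.sum_congr rfl fun i _ => ?_
  rw [Nat.mul_add, pow_add]
  ring

theorem pack_add (w n : ℕ) (u v : ℕ → ℕ) :
    pack w n u + pack w n v = pack w n (fun i => u i + v i) := by
  simp only [pack, ← Finset.sum_add_distrib, add_mul]

theorem pack_mul_right (w n : ℕ) (v : ℕ → ℕ) (c : ℕ) :
    pack w n v * c = pack w n (fun i => v i * c) := by
  simp only [pack, Finset.sum_mul, mul_right_comm]

theorem mul_pack (w n : ℕ) (v : ℕ → ℕ) (c : ℕ) :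
    c * pack w n v = pack w n (fun i => c * v i) := by
  simp only [pack, Finset.mul_sum, mul_assoc]

theorem pack_sub {w n : ℕ} {u v : ℕ → ℕ} (h : ∀ i < n, v i ≤ u i) :
    pack w n u - pack w n v = pack w n (fun i => u i - v i) := by
  rw [Nat.sub_eq_iff_eq_add, pack_add]
  · exact pack_congr fun i hi => (Nat.sub_add_cancel (h i hi)).symm
  · exact Finset.sum_le_sum fun i hi => Nat.mul_le_mul_right _ (h i (Finset.mem_range.1 hi))

theorem pack_mod {w m n : ℕ} {v : ℕ → ℕ} (h : ∀ i < m, v i < 2 ^ w) :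
    pack w (m + n) v % 2 ^ (w * m) = pack w m v := by
  rw [pack_add_length, Nat.mul_add_mod, Nat.mod_eq_of_lt (pack_lt h)]

theorem pack_shiftRight {w m n : ℕ} {v : ℕ → ℕ} (h : ∀ i < m, v i < 2 ^ w) :
    pack w (m + n) v >>> (w * m) = pack w n (fun i => v (m + i)) := by
  rw [pack_add_length, Nat.shiftRight_eq_div_pow, Nat.mul_add_div (by positivity),
    Nat.div_eq_of_lt (pack_lt h), add_zero]

theorem two_pow_mul_add_land {k a b c d : ℕ} (hb : b < 2 ^ k) (hd : d < 2 ^ k) :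
    (2 ^ k * a + b) &&& (2 ^ k * c + d) = 2 ^ k * (a &&& c) + (b &&& d) := by
  refine Nat.eq_of_testBit_eq fun i => ?_
  rw [Nat.testBit_and, Nat.testBit_two_pow_mul_add _ hb, Nat.testBit_two_pow_mul_add _ hd,
    Nat.testBit_two_pow_mul_add _ (lt_of_le_of_lt Nat.and_le_left hb)]
  split <;> simp

theorem pack_land {w n : ℕ} {u v : ℕ → ℕ} (hu : ∀ i < n, u i < 2 ^ w) (hv : ∀ i < n, v i < 2 ^ w) :
    pack w n u &&& pack w n v = pack w n (fun i => u i &&& v i) := by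
  induction n with
  | zero => simp [pack]
  | succ n ih =>
    have hu' := fun i (hi : i < n) => hu i (by omega)
    have hv' := fun i (hi : i < n) => hv i (by omega)
    simp only [pack_succ]
    rw [← ih hu' hv', add_comm, add_comm (pack w n v), mul_comm, mul_comm (v n),
      two_pow_mul_add_land (pack_lt hu') (pack_lt hv')]
    ring

theorem pack_eq_zero {w n : ℕ} {v : ℕ → ℕ} (h : pack w n v = 0) {i : ℕ} (hi : i < n) : v i = 0 := by
  have h1 := (Finset.sum_eq_zero_iff.1 h) i (Finset.mem_range.2 hi)
  simpa using h1

theorem pack_mul_pow (w n k : ℕ) (v : ℕ → ℕ) :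
    (pack w n v) <<< k = pack w n (fun i => v i * 2 ^ k) := by
  rw [Nat.shiftLeft_eq, pack_mul_right]

theorem pack_mul_length (w r n : ℕ) (v : ℕ → ℕ) :
    pack w (r * n) v = pack (w * r) n (fun j => pack w r (fun i => v (r * j + i))) := by
  induction n with
  | zero => simp [pack]
  | succ n ih =>
    rw [Nat.mul_succ, pack_add_length, ih, pack_succ, add_comm, mul_comm (2 ^ _), mul_assoc w]

theorem onesPack_eq (k : ℕ) : onesPack k = pack 768 (2 ^ k) fun _ => 1 := by
  induction k with
  | zero => simp [onesPack, pack]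
  | succ k ih =>
    rw [onesPack, ih, pow_succ, Nat.mul_two, pack_add_length, Nat.shiftLeft_eq, Nat.one_shiftLeft]
    ring

theorem onesRow_eq : onesRow = pack 48 16 fun _ => 1 := by
  decide +kernel

theorem onesPack_mul_onesRow (k : ℕ) :
    onesPack k * onesRow = pack 48 (16 * 2 ^ k) fun _ => 1 := by
  rw [onesPack_eq, onesRow_eq, pack_mul_length, pack_mul_right]
  simp only [one_mul]

theorem onesPack_eq_pack (k : ℕ) :
    onesPack k = pack 48 (16 * 2 ^ k) fun i => if i % 16 = 0 then 1 else 0 := by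
  rw [onesPack_eq, pack_mul_length]
  refine pack_congr fun j _ => ?_
  simp [pack, Finset.sum_range_succ]

/-- The entries of `levelPack`: the tail plus one of two rows for each of the first `k` bits. -/
def levelEntry (R : ℕ → ℕ → ℕ) (t : ℕ → ℕ) (k j z : ℕ) : ℕ :=
  t z + ∑ y ∈ Finset.range k, R (if j.testBit y then y + 16 else y) z

/-- Each step doubles the number of blocks: the lower half keeps bit `k` of the block index clear
and adds row `k`, the upper half sets it and adds row `k + 16`, which by antiperiodicity stands for
the opposite sign. -/
theorem levelPack_eq {H X : ℕ} {R : ℕ → ℕ → ℕ} {t : ℕ → ℕ} (hR : ∀ y < 32, row H y = pack 48 16 (R y))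
    (hX : X = pack 48 16 t) {k : ℕ} (hk : k ≤ 16) :
    levelPack H X k = pack 768 (2 ^ k) fun j => pack 48 16 (levelEntry R t k j) := by
  induction k with
  | zero =>
    rw [levelPack, hX, pow_zero, pack_one]
    refine pack_congr fun z _ => ?_
    simp only [levelEntry, Finset.sum_range_zero, add_zero]
  | succ k ih =>
    rw [levelPack, ih (by omega), hR k (by omega), hR (k + 16) (by omega), onesPack_eq, mul_pack,
      mul_pack, pack_add, pack_add, pow_succ 2 k, Nat.mul_two, pack_add_length, Nat.shiftLeft_eq,
      Nat.one_shiftLeft]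
    have h0 : ∀ j < 2 ^ k, j.testBit k = false := fun j hj => Nat.testBit_lt_two_pow hj
    refine (add_comm _ _).trans (congrArg₂ HAdd.hAdd ((mul_comm _ _).trans
      (congrArg (HMul.hMul _) (pack_congr fun j hj => ?_))) (pack_congr fun j hj => ?_))
    · rw [mul_one, pack_add]
      refine pack_congr fun z _ => ?_
      simp only [levelEntry, Finset.sum_range_succ, Nat.testBit_two_pow_add_eq, h0 j hj]
      rw [add_assoc]
      simp only [Bool.not_false, if_true]
      refine congrArg (fun s => t z + (s + R (k + 16) z)) (Finset.sum_congr rfl fun y hy => ?_)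
      rw [Nat.testBit_two_pow_add_gt (Finset.mem_range.1 hy)]
    · rw [mul_one, pack_add]
      refine pack_congr fun z _ => ?_
      simp only [levelEntry, Finset.sum_range_succ, h0 j hj]
      rw [add_assoc]
      rfl

/-- Bit 41 of a field tells whether it is at least `2 ^ 41`. Multiplied by `2 ^ 41 - 1` it becomes a
mask that extracts the positive part of `e - 2 ^ 41`; twice the positive part minus the number
itself is the absolute value. With truncated subtraction, one of the two summands on the right is
zero. -/
theorem absPack_eq {n : ℕ} {e : ℕ → ℕ} (he : ∀ i < n, e i < 2 ^ 42) :
    absPack (pack 48 n fun _ => 1) (pack 48 n e) =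
      pack 48 n fun i => (e i - 2 ^ 41) + (2 ^ 41 - e i) := by
  have h1 : pack 48 n e &&& (pack 48 n fun _ => 1) <<< 41 =
      (pack 48 n fun i => e i / 2 ^ 41) * 2 ^ 41 := by
    rw [pack_mul_pow, pack_mul_right, pack_land]
    · refine pack_congr fun i hi => ?_
      have hi := he i hi
      rw [one_mul]
      have h2 : e i = 2 ^ 41 * (e i / 2 ^ 41) + e i % 2 ^ 41 := (Nat.div_add_mod _ _).symm
      have h3 := two_pow_mul_add_land (k := 41) (a := e i / 2 ^ 41) (c := 1) (b := e i % 2 ^ 41)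
        (d := 0) (Nat.mod_lt _ (by norm_num)) (by norm_num)
      rw [← h2] at h3
      rw [show 2 ^ 41 = 2 ^ 41 * 1 + 0 by rfl, h3]
      have h4 : e i / 2 ^ 41 < 2 := by omega
      interval_cases e i / 2 ^ 41 <;> simp
    · exact fun i hi => lt_trans (he i hi) (by norm_num)
    · exact fun i hi => by norm_num
  have h2 : pack 48 n e &&& (pack 48 n fun i => e i / 2 ^ 41) * 2199023255551 =
      pack 48 n fun i => e i - 2 ^ 41 := by
    rw [pack_mul_right, pack_land]
    · refine pack_congr fun i hi => ?_
      have hi := he i hi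
      have h4 : e i / 2 ^ 41 = 0 ∨ e i / 2 ^ 41 = 1 := by omega
      rcases h4 with h4 | h4
      · rw [h4]; simp; omega
      · rw [h4, one_mul, show 2199023255551 = 2 ^ 41 - 1 by rfl, Nat.and_two_pow_sub_one_eq_mod]
        omega
    · exact fun i hi => lt_trans (he i hi) (by norm_num)
    · intro i hi
      have hi := he i hi
      have h4 : e i / 2 ^ 41 ≤ 1 := by omega
      exact lt_of_le_of_lt (Nat.mul_le_mul_right _ h4) (by norm_num)
  rw [absPack, h1, Nat.shiftRight_eq_div_pow, Nat.mul_div_cancel _ (by norm_num), h2, mul_pack,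
    pack_mul_pow, pack_add, pack_sub]
  · refine pack_congr fun i hi => ?_
    omega
  · intro i hi
    omega

theorem foldPack_eq {n c : ℕ} {v : ℕ → ℕ} (m : ℕ) (hv : ∀ i, v i ≤ c) (hc : c < 2 ^ 48)
    (h0 : ∀ i, n ≤ i → v i = 0) :
    ∃ u : ℕ → ℕ, (∀ i, u i = v i + v (i + m)) ∧ (∀ i, u i ≤ 2 * c) ∧ (∀ i, n ≤ i → u i = 0) ∧
      foldPack m (pack 48 n v) = pack 48 n u := by
  have h1 : ∀ l, pack 48 (n + l) v = pack 48 n v := by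
    intro l
    induction l with
    | zero => rfl
    | succ l ih => rw [← add_assoc, pack_succ, ih, h0 (n + l) (by omega), zero_mul, add_zero]
  refine ⟨fun i => v i + v (i + m), fun i => rfl, fun i => ?_, fun i hi => ?_, ?_⟩
  · have := hv i
    have := hv (i + m)
    dsimp only
    omega
  · have := h0 i hi
    have := h0 (i + m) (by omega)
    dsimp only
    omega
  · rw [foldPack, ← pack_add]
    refine congrArg (HAdd.hAdd _) ?_
    rw [← h1 m, add_comm n m, pack_shiftRight fun i _ => lt_of_le_of_lt (hv i) hc]
    exact pack_congr fun i _ => by rw [add_comm]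

/-- The added constant is `2 ^ 46 - 2000797767169`, so bit 46 is set exactly when the field exceeds
the bound; `2 ^ 45` as a prior bound excludes overflow past that bit. -/
theorem boundedPack_le {k : ℕ} {t : ℕ → ℕ} (ht : ∀ i, t i ≤ 2 ^ 45)
    (h : boundedPack (onesPack k) (pack 48 (16 * 2 ^ k) t) = true) {j : ℕ} (hj : j < 2 ^ k) :
    t (16 * j) ≤ 2000797767168 := by
  rw [boundedPack, Nat.beq_eq, onesPack_eq_pack, pack_mul_right, pack_add, pack_mul_pow,
    pack_land] at h
  · have h1 := pack_eq_zero h (show 16 * j < 16 * 2 ^ k by omega)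
    have hi := ht (16 * j)
    simp only [Nat.mul_mod_right, if_true, one_mul] at h1
    by_contra hc
    have h2 := congrArg (fun x => x.testBit 46) h1
    simp only [Nat.testBit_and, Nat.zero_testBit, Nat.testBit_two_pow_self, Bool.and_true] at h2
    have h3 : (t (16 * j) + 68367946410495).testBit 46 = true := by
      rw [Nat.testBit_eq_decide_div_mod_eq]
      simp only [decide_eq_true_eq]
      omega
    rw [h3] at h2
    exact absurd h2 (by decide)
  · intro i _
    have hi := ht i
    split <;> omega
  · intro i _
    split <;> norm_num

theorem checkBound_sum {n k : ℕ} {R : ℕ → ℕ → ℕ} {t : ℕ → ℕ} (hk : k ≤ 16)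
    (h : checkBound n k = true)
    (hR : ∀ y < 32, row (convPack n 16) y = pack 48 16 (R y))
    (ht : tailPack (convPack n 16) (16 - k) = pack 48 16 t)
    (hE : ∀ j < 2 ^ k, ∀ z < 16, levelEntry R t k j z < 2 ^ 42) {j : ℕ} (hj : j < 2 ^ k) :
    ∑ z ∈ Finset.range 16, ((levelEntry R t k j z - 2 ^ 41) + (2 ^ 41 - levelEntry R t k j z)) ≤
      2000797767168 := by
  set e : ℕ → ℕ := fun i => levelEntry R t k (i / 16) (i % 16) with he
  set d : ℕ → ℕ := fun i => if i < 16 * 2 ^ k then (e i - 2 ^ 41) + (2 ^ 41 - e i) else 0 with hd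
  have hX : levelPack (convPack n 16) (tailPack (convPack n 16) (16 - k)) k =
      pack 48 (16 * 2 ^ k) e := by
    rw [levelPack_eq hR ht hk, pack_mul_length]
    refine pack_congr fun j _ => pack_congr fun z hz => ?_
    simp only [he]
    rw [Nat.mul_add_div (by norm_num), Nat.mul_add_mod, Nat.div_eq_of_lt hz, Nat.mod_eq_of_lt hz,
      add_zero]
  have he' : ∀ i < 16 * 2 ^ k, e i < 2 ^ 42 := fun i hi => hE _ (by omega) _ (by omega)
  have hA : absPack (onesPack k * onesRow) (pack 48 (16 * 2 ^ k) e) = pack 48 (16 * 2 ^ k) d := by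
    rw [onesPack_mul_onesRow, absPack_eq he']
    exact pack_congr fun i hi => by rw [hd]; simp [hi]
  have hd1 : ∀ i, d i ≤ 2 ^ 41 := by
    intro i
    simp only [hd]
    split
    · have := he' i ‹_›
      omega
    · omega
  have hd0 : ∀ i, 16 * 2 ^ k ≤ i → d i = 0 := fun i hi => by simp only [hd]; rw [if_neg (by omega)]
  have h1 : ∀ z < 16, (levelEntry R t k j z - 2 ^ 41) + (2 ^ 41 - levelEntry R t k j z) =
      d (16 * j + z) := by
    intro z hz
    simp only [hd, he]
    rw [if_pos (by omega), Nat.mul_add_div (by norm_num), Nat.mul_add_mod, Nat.div_eq_of_lt hz,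
      Nat.mod_eq_of_lt hz, add_zero]
  rw [Finset.sum_congr rfl fun z hz => h1 z (Finset.mem_range.1 hz)]
  rw [checkBound, hX, hA] at h
  clear_value d
  -- Folding by 8, 4, 2, 1 collects sixteen consecutive fields in the lowest of them and raises the
  -- field bound from `2 ^ 41` to `2 ^ 45`. The other fields hold sums across blocks, which the test
  -- ignores.
  obtain ⟨d1, e1, b1, z1, p1⟩ := foldPack_eq 8 hd1 (by norm_num) hd0
  obtain ⟨d2, e2, b2, z2, p2⟩ := foldPack_eq 4 b1 (by norm_num) z1
  obtain ⟨d3, e3, b3, z3, p3⟩ := foldPack_eq 2 b2 (by norm_num) z2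
  obtain ⟨d4, e4, b4, -, p4⟩ := foldPack_eq 1 b3 (by norm_num) z3
  rw [p1, p2, p3, p4] at h
  refine le_trans (le_of_eq ?_) (boundedPack_le (fun i => (b4 i).trans (by norm_num)) h hj)
  simp only [e4, e3, e2, e1, Finset.sum_range_succ, Finset.sum_range_zero, add_assoc,
    Nat.reduceAdd, add_zero]
  ring


/-! ### Antiperiodic sign sequences, their codes and rotations -/

/-- Sequences of signs that change sign when the argument is increased by 16. -/
structure IsSignSeq (A : ZMod 32 → ℤ) : Prop where
  unit : ∀ x, A x = 1 ∨ A x = -1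
  anti : ∀ x, A (x + 16) = -A x

theorem IsSignSeq.shift {A : ZMod 32 → ℤ} (hA : IsSignSeq A) (s : ZMod 32) :
    IsSignSeq fun x => A (x + s) :=
  ⟨fun x => hA.unit _, fun x => by rw [add_right_comm, hA.anti]⟩

/-- The sign sequence whose signs at `0, …, 15` are the first 16 binary digits of `n`. -/
def codeSeq (n : ℕ) (x : ZMod 32) : ℤ :=
  (if n.testBit (x.val % 16) then -1 else 1) * (if x.val < 16 then 1 else -1)

theorem val_mod_add_sixteen : ∀ x : ZMod 32, (x + 16).val % 16 = x.val % 16 := by decide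

theorem val_add_sixteen_lt : ∀ x : ZMod 32, (x + 16).val < 16 ↔ ¬ x.val < 16 := by decide

theorem isSignSeq_codeSeq (n : ℕ) : IsSignSeq (codeSeq n) := by
  constructor
  · intro x
    simp only [codeSeq]
    split <;> split <;> simp
  · intro x
    simp only [codeSeq, val_mod_add_sixteen, val_add_sixteen_lt]
    by_cases h : x.val < 16 <;> simp [h]

theorem codeSeq_natCast (n : ℕ) {x : ℕ} (hx : x < 16) :
    codeSeq n (x : ZMod 32) = if n.testBit x then -1 else 1 := by
  have h : ((x : ℕ) : ZMod 32).val = x := ZMod.val_natCast_of_lt (by omega)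
  rw [codeSeq, h, Nat.mod_eq_of_lt hx, if_pos hx, mul_one]

theorem IsSignSeq.ext {A B : ZMod 32 → ℤ} (hA : IsSignSeq A) (hB : IsSignSeq B)
    (h : ∀ x : ℕ, x < 16 → A x = B x) : A = B := by
  funext x
  have hx : ((x.val : ℕ) : ZMod 32) = x := ZMod.natCast_zmod_val x
  have hlt := ZMod.val_lt x
  by_cases hx' : x.val < 16
  · rw [← hx, h _ hx']
  · have h1 : x = ((x.val - 16 : ℕ) : ZMod 32) + 16 := by
      rw [Nat.cast_sub (by omega), hx]
      push_cast
      ring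
    rw [h1, hA.anti, hB.anti, h _ (by omega)]

theorem rotCode_eq (n : ℕ) :
    rotCode n = 2 ^ 15 * (1 - n % 2) + n / 2 := by
  rw [rotCode, Nat.shiftRight_eq_div_pow, Nat.shiftLeft_eq]
  ring

theorem rotCode_lt {n : ℕ} (hn : n < 2 ^ 16) : rotCode n < 2 ^ 16 := by
  rw [rotCode_eq]
  omega

/-- By antiperiodicity, the bit that drops out at the bottom reenters complemented at the top. -/
theorem codeSeq_rotCode {n : ℕ} (hn : n < 2 ^ 16) :
    codeSeq (rotCode n) = fun x => codeSeq n (x + 1) := by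
  refine (isSignSeq_codeSeq _).ext ((isSignSeq_codeSeq n).shift 1) fun x hx => ?_
  rw [codeSeq_natCast _ hx, rotCode_eq, Nat.testBit_two_pow_mul_add _ (by omega)]
  by_cases h : x < 15
  · rw [if_pos h, ← Nat.cast_add_one, codeSeq_natCast _ (by omega), Nat.testBit_add_one]
  · have h15 : x = 15 := by omega
    subst h15
    have h1 : (((15 : ℕ) : ZMod 32) + 1) = ((0 : ℕ) : ZMod 32) + 16 := by decide
    rw [h1, (isSignSeq_codeSeq n).anti, codeSeq_natCast _ (by norm_num), Nat.testBit_zero]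
    rcases Nat.mod_two_eq_zero_or_one n with h2 | h2 <;> simp [h2]

theorem IsSignSeq.exists_code {A : ZMod 32 → ℤ} (hA : IsSignSeq A) :
    ∃ n < 2 ^ 16, codeSeq n = A := by
  refine ⟨Nat.ofBits fun i : Fin 16 => decide (A (i : ℕ) = -1), Nat.ofBits_lt_two_pow _, ?_⟩
  refine (isSignSeq_codeSeq _).ext hA fun x hx => ?_
  rw [codeSeq_natCast _ hx, Nat.testBit_ofBits_lt _ _ hx]
  rcases hA.unit x with h | h <;> simp [h]

/-- Without two adjacent plus signs there are no two adjacent minus signs either, these being the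
former shifted by 16. The sequence would then alternate, giving `A 16 = A 0` against `A 16 = -A 0`.
-/
theorem IsSignSeq.exists_run {A : ZMod 32 → ℤ} (hA : IsSignSeq A) :
    ∃ s, A (14 + s) = 1 ∧ A (15 + s) = 1 := by
  by_contra hc
  have h1 : ∀ x, A (x + 1) = -A x := by
    intro x
    rcases hA.unit x with h | h <;> rcases hA.unit (x + 1) with h' | h'
    · exact absurd ⟨x - 14, by rw [← h]; congr 1; ring, by rw [← h']; congr 1; ring⟩ hc
    · rw [h, h']
    · rw [h, h', neg_neg]
    · exact absurd ⟨x + 16 - 14, by rw [show 14 + (x + 16 - 14) = x + 16 by ring, hA.anti, h]; rfl,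
        by rw [show 15 + (x + 16 - 14) = x + 1 + 16 by ring, hA.anti, h']; rfl⟩ hc
  have h2 : ∀ n : ℕ, A (n : ZMod 32) = (-1) ^ n * A 0 := by
    intro n
    induction n with
    | zero => simp
    | succ n ih => rw [Nat.cast_succ, h1, ih, pow_succ]; ring
  have h3 := h2 16
  have h4 := hA.anti 0
  rw [zero_add] at h4
  rw [show ((16 : ℕ) : ZMod 32) = 16 by rfl, h4] at h3
  rcases hA.unit 0 with h | h <;> rw [h] at h3 <;> norm_num at h3

theorem hasSmallerRotation_eq_false {n : ℕ} (P : ℕ → Prop) (h1 : ∀ c, P c → P (rotCode c))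
    (h2 : ∀ c, P c → n ≤ c) (t c : ℕ) (hc : P c) : hasSmallerRotation n t c = false := by
  induction t generalizing c with
  | zero => rfl
  | succ t ih =>
    rw [hasSmallerRotation, ih _ (h1 c hc), Bool.or_false]
    have := h2 _ (h1 c hc)
    rw [Bool.eq_false_iff, Ne, Nat.blt_eq]
    omega

/-- Rotating a run of two plus signs to positions 14 and 15 clears the two top bits, so the least
code in the orbit is below `2 ^ 14`. -/
theorem IsSignSeq.exists_min_code {A : ZMod 32 → ℤ} (hA : IsSignSeq A) :
    ∃ n s, n < 2 ^ 14 ∧ codeSeq n = (fun x => A (x + s)) ∧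
      hasSmallerRotation n 31 n = false := by
  classical
  let P : ℕ → Prop := fun n => n < 2 ^ 16 ∧ ∃ s, codeSeq n = fun x => A (x + s)
  have hP : ∃ n, P n ∧ n < 2 ^ 14 := by
    obtain ⟨s, h14, h15⟩ := hA.exists_run
    obtain ⟨n, hn, h⟩ := (hA.shift s).exists_code
    refine ⟨n, ⟨hn, s, h⟩, ?_⟩
    have b14 := codeSeq_natCast n (x := 14) (by norm_num)
    have b15 := codeSeq_natCast n (x := 15) (by norm_num)
    rw [h] at b14 b15
    simp only [Nat.cast_ofNat] at b14 b15
    rw [h14, Nat.testBit_eq_decide_div_mod_eq] at b14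
    rw [h15, Nat.testBit_eq_decide_div_mod_eq] at b15
    simp only [decide_eq_true_eq] at b14 b15
    split at b14
    · norm_num at b14
    · split at b15
      · norm_num at b15
      · omega
  obtain ⟨m, hm, hm'⟩ := hP
  have hex : ∃ n, P n := ⟨m, hm⟩
  obtain ⟨hlt, s, hs⟩ := Nat.find_spec hex
  refine ⟨Nat.find hex, s, lt_of_le_of_lt (Nat.find_min' hex hm) hm', hs, ?_⟩
  refine hasSmallerRotation_eq_false P ?_ (fun c hc => Nat.find_min' hex hc) _ _
    (Nat.find_spec hex)
  rintro c ⟨hc, s, hs⟩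
  refine ⟨rotCode_lt hc, 1 + s, ?_⟩
  rw [codeSeq_rotCode hc, hs]
  simp only [add_assoc]

/-! ### The trilinear form -/

/-- The Bell expression, extended to a sum over `ZMod 32` for each party. -/
def triForm (A B C : ZMod 32 → ℤ) : ℤ := ∑ x, ∑ y, ∑ z, profile (x + y + z) * A x * B y * C z

theorem triForm_swap (A B C : ZMod 32 → ℤ) : triForm A B C = triForm B A C := by
  rw [triForm, Finset.sum_comm]
  refine Finset.sum_congr rfl fun x _ => Finset.sum_congr rfl fun y _ =>
    Finset.sum_congr rfl fun z _ => ?_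
  rw [add_comm y x]
  ring

/-- The form depends only on `x + y + z`, so the first two parties can be rotated independently
while the third compensates. -/
theorem triForm_shift (A B C : ZMod 32 → ℤ) (s t : ZMod 32) :
    triForm (fun x => A (x + s)) (fun x => B (x + t)) (fun x => C (x + -(s + t))) =
      triForm A B C := by
  refine Fintype.sum_equiv (Equiv.addRight s) _ _ fun x => ?_
  refine Fintype.sum_equiv (Equiv.addRight t) _ _ fun y => ?_
  refine Fintype.sum_equiv (Equiv.addRight (-(s + t))) _ _ fun z => ?_
  simp only [Equiv.coe_addRight]
  rw [show x + s + (y + t) + (z + -(s + t)) = x + y + z by ring]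

theorem profile_anti : ∀ s, profile (s + 16) = -profile s := by decide

theorem profile_even : ∀ s, profile (-s) = profile s := by decide

theorem sum_zmod_eq {M : Type*} [AddCommMonoid M] (φ : ZMod 32 → M) :
    ∑ x, φ x = ∑ i ∈ Finset.range 32, φ (i : ZMod 32) := by
  rw [← Fin.sum_univ_eq_sum_range (fun i => φ (i : ZMod 32)) 32]
  refine Finset.sum_congr rfl fun i _ => ?_
  exact congrArg φ (ZMod.natCast_zmod_val (n := 32) i).symm

theorem sum_zmod_periodic {M : Type*} [AddCommMonoid M] {φ : ZMod 32 → M}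
    (h : ∀ x, φ (x + 16) = φ x) :
    ∑ x, φ x = 2 • ∑ i ∈ Finset.range 16, φ (i : ZMod 32) := by
  rw [sum_zmod_eq, Finset.sum_range_add _ 16 16, two_nsmul]
  congr 1
  refine Finset.sum_congr rfl fun i _ => ?_
  rw [← h (i : ZMod 32)]
  congr 1
  push_cast
  ring

/-- A shift by 16 in one variable flips both the coefficient and one sign, so each of the three sums
is twice a sum over half a period. -/
theorem triForm_eq {A B C : ZMod 32 → ℤ} (hA : IsSignSeq A) (hB : IsSignSeq B)
    (hC : IsSignSeq C) :
    triForm A B C = 8 * ∑ z ∈ Finset.range 16, C z *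
      ∑ y ∈ Finset.range 16, B y * ∑ x ∈ Finset.range 16, profile (x + y + z) * A x := by
  have h1 : triForm A B C = ∑ z, C z * ∑ y, B y * ∑ x, profile (x + y + z) * A x := by
    rw [triForm, Finset.sum_comm]
    simp_rw [Finset.mul_sum]
    rw [Finset.sum_congr rfl fun y _ => Finset.sum_comm, Finset.sum_comm]
    refine Finset.sum_congr rfl fun z _ => Finset.sum_congr rfl fun y _ =>
      Finset.sum_congr rfl fun x _ => ?_
    ring
  have h2 : ∀ y z, ∑ x, profile (x + y + z) * A x =
      2 * ∑ x ∈ Finset.range 16, profile (x + y + z) * A x := by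
    intro y z
    rw [sum_zmod_periodic, two_nsmul, two_mul]
    intro x
    rw [hA.anti, show x + 16 + y + z = x + y + z + 16 by ring, profile_anti]
    ring
  have h3 : ∀ z, ∑ y, B y * ∑ x, profile (x + y + z) * A x =
      4 * ∑ y ∈ Finset.range 16, B y * ∑ x ∈ Finset.range 16, profile (x + y + z) * A x := by
    intro z
    simp_rw [h2]
    rw [sum_zmod_periodic, two_nsmul, Finset.mul_sum, ← Finset.sum_add_distrib]
    · exact Finset.sum_congr rfl fun _ _ => by ring
    · intro y
      have h4 : ∀ x, profile (x + (y + 16) + z) = -profile (x + y + z) := fun x => by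
        rw [show x + (y + 16) + z = x + y + z + 16 by ring, profile_anti]
      simp_rw [h4, hB.anti, neg_mul, Finset.sum_neg_distrib]
      ring
  rw [h1]
  simp_rw [h3]
  rw [sum_zmod_periodic, two_nsmul, Finset.mul_sum, ← Finset.sum_add_distrib]
  · exact Finset.sum_congr rfl fun _ _ => by ring
  · intro z
    have h4 : ∀ x y, profile (x + y + (z + 16)) = -profile (x + y + z) := fun x y => by
      rw [← add_assoc, profile_anti]
    simp_rw [h4, hC.anti, neg_mul, Finset.sum_neg_distrib, mul_neg, Finset.sum_neg_distrib]
    ring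

/-! ### The packed convolution -/

/-- The fields of `profilePack`. -/
def profileField (s : ℕ) : ℕ := (profile (s : ZMod 32) + 2 ^ 33).toNat

theorem profilePack_eq : profilePack = pack 48 80 profileField := by decide +kernel

theorem profile_bound : ∀ s, 0 ≤ profile s + 2 ^ 33 ∧ profile s + 2 ^ 33 < 2 ^ 34 := by decide

theorem profileField_cast (s : ℕ) : (profileField s : ℤ) = profile (s : ZMod 32) + 2 ^ 33 :=
  Int.toNat_of_nonneg (profile_bound _).1

theorem profileField_lt (s : ℕ) : profileField s < 2 ^ 34 := by
  have h1 := profileField_cast s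
  have h2 := (profile_bound s).2
  omega

/-- The fields of `convPack`. -/
def convField (n t s : ℕ) : ℕ :=
  ∑ x ∈ Finset.range t, profileField (x + 16 * ((n >>> x) % 2) + s)

theorem convField_lt (n s : ℕ) : convField n 16 s < 2 ^ 38 := by
  refine (Finset.sum_lt_sum_of_nonempty ⟨0, by simp⟩ fun x _ => profileField_lt _).trans_le ?_
  simp

set_option exponentiation.threshold 2304 in
theorem convPack_eq (n : ℕ) {t : ℕ} (ht : t ≤ 16) :
    convPack n t = pack 48 48 (convField n t) := by
  induction t with
  | zero => simp [convPack, convField, pack]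
  | succ t ih =>
    have hb : ∀ i, profileField i < 2 ^ 48 := fun i =>
      lt_trans (profileField_lt i) (by norm_num)
    have hm := Nat.mod_lt (n >>> t) (show 2 > 0 by norm_num)
    -- A shift of at most 31 followed by a window of 48 fields fits into the 80 stored fields.
    have h80 : 80 = (t + 16 * ((n >>> t) % 2)) + (48 + (32 - t - 16 * ((n >>> t) % 2))) := by
      omega
    rw [convPack, ih (by omega), profilePack_eq, Nat.one_shiftLeft,
      show 2304 = 48 * 48 by norm_num]
    conv_lhs => enter [2, 1, 1]; rw [h80]
    rw [pack_shiftRight fun i _ => hb i, pack_mod fun i _ => hb _, pack_add]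
    exact pack_congr fun i _ => by rw [convField, convField, Finset.sum_range_succ]

set_option exponentiation.threshold 768 in
theorem row_convPack (n : ℕ) {y : ℕ} (hy : y < 32) :
    row (convPack n 16) y = pack 48 16 fun z => convField n 16 (y + z) := by
  have hb : ∀ i, convField n 16 i < 2 ^ 48 := fun i =>
    lt_trans (convField_lt n i) (by norm_num)
  have h48 : 48 = y + (16 + (32 - y)) := by omega
  rw [row, convPack_eq n le_rfl, Nat.one_shiftLeft, show 768 = 48 * 16 by norm_num]
  conv_lhs => enter [1, 1]; rw [show pack 48 48 = pack 48 (y + (16 + (32 - y))) by rw [← h48]]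
  rw [pack_shiftRight fun i _ => hb i, pack_mod fun i _ => hb _]

theorem tailPack_eq {H : ℕ} {R : ℕ → ℕ → ℕ} (hR : ∀ y < 32, row H y = pack 48 16 (R y)) {t : ℕ}
    (ht : t ≤ 16) :
    tailPack H t = pack 48 16 fun z => ∑ y ∈ Finset.Ico (16 - t) 16, R y z := by
  induction t with
  | zero => simp [tailPack, pack]
  | succ t ih =>
    rw [tailPack, ih (by omega), hR _ (by omega), pack_add]
    refine pack_congr fun z _ => ?_
    rw [Finset.sum_eq_sum_Ico_succ_bot (show 16 - (t + 1) < 16 by omega),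
      show 16 - (t + 1) + 1 = 16 - t by omega, add_comm, show 15 - t = 16 - (t + 1) by omega]

/-- A minus sign is realised by reading the coefficients 16 places further on, so all fields stay
nonnegative. The offset is `16 * 2 ^ 33 = 2 ^ 37`. -/
theorem convField_cast (n s : ℕ) :
    (convField n 16 s : ℤ) =
      ∑ x ∈ Finset.range 16, profile (x + s) * codeSeq n x + 2 ^ 37 := by
  have h : ∀ x ∈ Finset.range 16, (profileField (x + 16 * ((n >>> x) % 2) + s) : ℤ) =
      profile (x + s) * codeSeq n x + 2 ^ 33 := by
    intro x hx
    rw [profileField_cast, codeSeq_natCast n (Finset.mem_range.1 hx),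
      Nat.testBit_eq_decide_div_mod_eq, Nat.shiftRight_eq_div_pow]
    rcases Nat.mod_two_eq_zero_or_one (n / 2 ^ x) with h | h
    · simp [h]
    · rw [h]
      push_cast
      rw [show (x : ZMod 32) + 16 + s = x + s + 16 by ring, profile_anti]
      simp
  rw [convField, Nat.cast_sum, Finset.sum_congr rfl h, Finset.sum_add_distrib]
  simp

theorem convField_cast_anti (n s : ℕ) :
    (convField n 16 (s + 16) : ℤ) - 2 ^ 37 = -((convField n 16 s : ℤ) - 2 ^ 37) := by
  rw [convField_cast, convField_cast, add_sub_cancel_right, add_sub_cancel_right,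
    ← Finset.sum_neg_distrib]
  refine Finset.sum_congr rfl fun x _ => ?_
  push_cast
  rw [← add_assoc, profile_anti, neg_mul]

/-- For fixed first and second parties no choice of `C` exceeds the sum of the absolute values of
its coefficients, which is what `checkBound` tests for every `j` at once. -/
theorem triForm_le_of_checkBound {n k j : ℕ} (hk : k ≤ 16) (h : checkBound n k = true)
    (hj : j < 2 ^ k) {C : ZMod 32 → ℤ} (hC : IsSignSeq C) :
    triForm (codeSeq n) (codeSeq j) C ≤ 8 * 2000797767168 := by
  set R : ℕ → ℕ → ℕ := fun y z => convField n 16 (y + z) with hR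
  set t : ℕ → ℕ := fun z => ∑ y ∈ Finset.Ico k 16, R y z with ht
  have hrow : ∀ y < 32, row (convPack n 16) y = pack 48 16 (R y) := fun y hy => row_convPack n hy
  have htail : tailPack (convPack n 16) (16 - k) = pack 48 16 t := by
    rw [tailPack_eq hrow (by omega), show 16 - (16 - k) = k by omega]
  have hRb : ∀ y z, R y z < 2 ^ 38 := fun y z =>
    convField_lt n _
  have hbits : ∀ j < 2 ^ k, ∀ z, levelEntry R t k j z =
      ∑ y ∈ Finset.range 16, R (if j.testBit y then y + 16 else y) z := by
    intro j hj z
    -- Since `j < 2 ^ k`, its bits from position `k` on are zero, so the tail rows, common to all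
    -- blocks, enter with a plus sign.
    have h1 : t z = ∑ y ∈ Finset.Ico k 16, R (if j.testBit y then y + 16 else y) z := by
      refine Finset.sum_congr rfl fun y hy => ?_
      have hky : 2 ^ k ≤ 2 ^ y := Nat.pow_le_pow_right (by norm_num) (Finset.mem_Ico.1 hy).1
      rw [Nat.testBit_lt_two_pow (by omega)]
      rfl
    rw [levelEntry, h1, add_comm]
    exact Finset.sum_range_add_sum_Ico _ hk
  have hE : ∀ j < 2 ^ k, ∀ z < 16, levelEntry R t k j z < 2 ^ 42 := by
    intro j hj z _
    rw [hbits j hj]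
    refine (Finset.sum_lt_sum_of_nonempty ⟨0, by simp⟩ fun y _ => hRb _ _).trans_le ?_
    simp
  have hS : ∀ z, (levelEntry R t k j z : ℤ) = ∑ y ∈ Finset.range 16, codeSeq j y *
      ∑ x ∈ Finset.range 16, profile (x + y + z) * codeSeq n x + 2 ^ 41 := by
    intro z
    have h1 : ∀ y ∈ Finset.range 16, (R (if j.testBit y then y + 16 else y) z : ℤ) =
        codeSeq j y * ∑ x ∈ Finset.range 16, profile (x + y + z) * codeSeq n x + 2 ^ 37 := by
      intro y hy
      have h2 := convField_cast n (y + z)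
      push_cast [← add_assoc] at h2
      rw [codeSeq_natCast j (Finset.mem_range.1 hy), hR]
      split
      · have h3 := convField_cast_anti n (y + z)
        rw [h2] at h3
        dsimp only
        rw [add_right_comm]
        linarith
      · dsimp only
        rw [h2, one_mul]
        norm_num
    rw [hbits j hj, Nat.cast_sum, Finset.sum_congr rfl h1, Finset.sum_add_distrib]
    simp
  have hsum := checkBound_sum hk h hrow htail hE hj
  rw [triForm_eq (isSignSeq_codeSeq n) (isSignSeq_codeSeq j) hC]
  refine mul_le_mul_of_nonneg_left ?_ (by norm_num)
  refine le_trans ?_ (Int.ofNat_le.2 hsum)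
  rw [Nat.cast_sum]
  refine Finset.sum_le_sum fun z _ => ?_
  have hz := hS z
  generalize levelEntry R t k j z = e at hz
  generalize (∑ y ∈ Finset.range 16, codeSeq j y *
    ∑ x ∈ Finset.range 16, profile (x + y + z) * codeSeq n x) = S at hz
  rcases hC.unit z with hc | hc <;> rw [hc] <;> omega

theorem checkBoundFrom_sound {n t : ℕ} (h : checkBoundFrom n t = true) (hn : n < 2 ^ t) :
    ∃ k ≤ t, n < 2 ^ k ∧ checkBound n k = true := by
  induction t with
  | zero => exact ⟨0, le_rfl, hn, h⟩
  | succ t ih =>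
    rw [checkBoundFrom, Bool.cond_eq_ite] at h
    split at h
    · exact ⟨t + 1, le_rfl, hn, h⟩
    · next hc =>
      rw [Nat.ble_eq, Nat.one_shiftLeft, not_le] at hc
      obtain ⟨k, hk, h1⟩ := ih h hc
      exact ⟨k, hk.trans (Nat.le_succ t), h1⟩

theorem checkCodes_sound {d n : ℕ} (h : checkCodes d n = true) {m : ℕ} (hm : m / 2 ^ d = n) :
    checkCode m = true := by
  induction d generalizing n with
  | zero =>
    rw [pow_zero, Nat.div_one] at hm
    rw [hm]
    exact h
  | succ d ih =>
    rw [checkCodes, Bool.and_eq_true] at h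
    rw [pow_succ, ← Nat.div_div_eq_div_mul] at hm
    rcases Nat.mod_two_eq_zero_or_one (m / 2 ^ d) with h2 | h2
    · exact ih h.1 (by omega)
    · exact ih h.2 (by omega)

/-- After both codes are made least in their orbits, symmetry lets the smaller one be the second; it
is then covered by the block size `2 ^ k` chosen for the larger. -/
theorem triForm_le_of_checkCode (h : ∀ n < 2 ^ 14, checkCode n = true) {A B C : ZMod 32 → ℤ}
    (hA : IsSignSeq A) (hB : IsSignSeq B) (hC : IsSignSeq C) :
    triForm A B C ≤ 8 * 2000797767168 := by
  obtain ⟨n, s, hn, hns, hn'⟩ := hA.exists_min_code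
  obtain ⟨m, t, hm, hmt, hm'⟩ := hB.exists_min_code
  have key : ∀ n m : ℕ, n < 2 ^ 14 → hasSmallerRotation n 31 n = false → m ≤ n →
      ∀ {C}, IsSignSeq C → triForm (codeSeq n) (codeSeq m) C ≤ 8 * 2000797767168 := by
    intro n m hn hn' hmn C hC
    have h1 := h n hn
    rw [checkCode, hn', Bool.false_or] at h1
    obtain ⟨k, hk, hnk, h2⟩ := checkBoundFrom_sound h1 hn
    exact triForm_le_of_checkBound (by omega) h2 (lt_of_le_of_lt hmn hnk) hC
  rw [← triForm_shift A B C s t, ← hns, ← hmt]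
  rcases le_total m n with hmn | hmn
  · exact key n m hn hn' hmn (hC.shift _)
  · rw [triForm_swap]
    exact key m n hm hm' hmn (hC.shift _)


/-! ### Kernel evaluation for all codes of 14 bits, split by their four leading bits -/

theorem checkCodes_ten_0 : checkCodes 10 0 = true := by decide +kernel

theorem checkCodes_ten_1 : checkCodes 10 1 = true := by decide +kernel

theorem checkCodes_ten_2 : checkCodes 10 2 = true := by decide +kernel

theorem checkCodes_ten_3 : checkCodes 10 3 = true := by decide +kernel

theorem checkCodes_ten_4 : checkCodes 10 4 = true := by decide +kernel

theorem checkCodes_ten_5 : checkCodes 10 5 = true := by decide +kernel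

theorem checkCodes_ten_6 : checkCodes 10 6 = true := by decide +kernel

theorem checkCodes_ten_7 : checkCodes 10 7 = true := by decide +kernel

theorem checkCodes_ten_8 : checkCodes 10 8 = true := by decide +kernel

theorem checkCodes_ten_9 : checkCodes 10 9 = true := by decide +kernel

theorem checkCodes_ten_10 : checkCodes 10 10 = true := by decide +kernel

theorem checkCodes_ten_11 : checkCodes 10 11 = true := by decide +kernel

theorem checkCodes_ten_12 : checkCodes 10 12 = true := by decide +kernel

theorem checkCodes_ten_13 : checkCodes 10 13 = true := by decide +kernel

theorem checkCodes_ten_14 : checkCodes 10 14 = true := by decide +kernel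

theorem checkCodes_ten_15 : checkCodes 10 15 = true := by decide +kernel

theorem checkCodes_ten : ∀ n : Fin 16, checkCodes 10 n = true := by
  intro n
  fin_cases n
  · exact checkCodes_ten_0
  · exact checkCodes_ten_1
  · exact checkCodes_ten_2
  · exact checkCodes_ten_3
  · exact checkCodes_ten_4
  · exact checkCodes_ten_5
  · exact checkCodes_ten_6
  · exact checkCodes_ten_7
  · exact checkCodes_ten_8
  · exact checkCodes_ten_9
  · exact checkCodes_ten_10
  · exact checkCodes_ten_11
  · exact checkCodes_ten_12
  · exact checkCodes_ten_13
  · exact checkCodes_ten_14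
  · exact checkCodes_ten_15

/-- The local bound, for sequences of signs on `ZMod 32`. -/
theorem triForm_le {A B C : ZMod 32 → ℤ} (hA : IsSignSeq A) (hB : IsSignSeq B)
    (hC : IsSignSeq C) : triForm A B C ≤ 8 * 2000797767168 := by
  refine triForm_le_of_checkCode (fun n hn => ?_) hA hB hC
  exact checkCodes_sound (checkCodes_ten ⟨n / 2 ^ 10, by omega⟩) rfl


/-! ### Bell expressions as linear functionals -/

/-- The Bell expression with coefficients `M` as a linear functional. -/
def bellLin {m : ℕ} (M : Tensor m) : Tensor m →ₗ[ℝ] ℝ where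
  toFun := bellValue M
  map_add' r s := by simp only [bellValue, Pi.add_apply, mul_add, Finset.sum_add_distrib]
  map_smul' t r := by
    simp only [bellValue, Pi.smul_apply, smul_eq_mul, RingHom.id_apply, Finset.mul_sum]
    exact Finset.sum_congr rfl fun i _ => Finset.sum_congr rfl fun j _ =>
      Finset.sum_congr rfl fun k _ => by ring

@[simp] theorem bellLin_apply {m : ℕ} (M r : Tensor m) : bellLin M r = bellValue M r := rfl

theorem bellValue_le_of_mem {m : ℕ} {M : Tensor m} {ℓ : ℝ}
    (h : ∀ a b c, bellValue M (detStrategy a b c) ≤ ℓ) {r : Tensor m} (hr : r ∈ localPolytope m) :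
    bellValue M r ≤ ℓ := by
  refine convexHull_min ?_ (convex_halfSpace_le (bellLin M).isLinear ℓ) hr
  rintro _ ⟨a, b, c, rfl⟩
  exact h a b c

/-! ### Sums over the inputs and sums over `ZMod 32` -/

theorem sum_zmod_periodic_fin {M : Type*} [AddCommMonoid M] {φ : ZMod 32 → M}
    (h : ∀ x, φ (x + 16) = φ x) : ∑ x, φ x = 2 • ∑ i : Fin 16, φ ((i : ℕ) : ZMod 32) := by
  rw [sum_zmod_periodic h, Fin.sum_univ_eq_sum_range (fun i => φ (i : ZMod 32)) 16]

theorem sum_zmod_periodic_three {ψ : ZMod 32 → ZMod 32 → ZMod 32 → ℝ}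
    (h1 : ∀ x y z, ψ (x + 16) y z = ψ x y z) (h2 : ∀ x y z, ψ x (y + 16) z = ψ x y z)
    (h3 : ∀ x y z, ψ x y (z + 16) = ψ x y z) :
    ∑ x, ∑ y, ∑ z, ψ x y z = 8 * ∑ x : Fin 16, ∑ y : Fin 16, ∑ z : Fin 16,
      ψ ((x : ℕ) : ZMod 32) ((y : ℕ) : ZMod 32) ((z : ℕ) : ZMod 32) := by
  have e3 : ∀ x y, ∑ z, ψ x y z = 2 * ∑ z : Fin 16, ψ x y ((z : ℕ) : ZMod 32) := fun x y => by
    rw [sum_zmod_periodic_fin (h3 x y), two_nsmul, two_mul]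
  have e2 : ∀ x, ∑ y, ∑ z, ψ x y z =
      4 * ∑ y : Fin 16, ∑ z : Fin 16, ψ x ((y : ℕ) : ZMod 32) ((z : ℕ) : ZMod 32) := fun x => by
    rw [sum_zmod_periodic_fin, two_nsmul]
    · simp_rw [e3, ← Finset.mul_sum]
      ring
    · exact fun y => by simp_rw [h2]
  rw [sum_zmod_periodic_fin, two_nsmul]
  · simp_rw [e2, ← Finset.mul_sum]
    ring
  · exact fun x => by simp_rw [h1]

/-- The common denominator is `3907808139 = 3 * 137 * 9508049`, and 512 times it is the integer
local bound. The largest argument that occurs is `15 + 15 + 15`. -/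
theorem bellCoeff_eq {s : ℕ} (hs : s < 46) :
    bellCoeff s = (profile (s : ZMod 32) : ℝ) / 2000797767168 := by
  have h : ∀ t : Fin 16, bellProfile t = (profile ((t : ℕ) : ZMod 32) : ℝ) / 3907808139 := by
    have h0 : ∀ t : Fin 16, profile ((t : ℕ) : ZMod 32) =
        ![3907808139, 4915849344, -3422897640, 6337527936, 2605205426, -2241495360, -1597352232, -4709652288,
          0, 4709652288, 1597352232, 2241495360, -2605205426, -6337527936, 3422897640, -4915849344] t := by decide
    intro t
    rw [h0]
    fin_cases t <;> simp [bellProfile] <;> norm_num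
  have h2 : ∀ s : Fin 46, profile ((s : ℕ) : ZMod 32) =
      (-1) ^ ((s : ℕ) / 16) * profile (((Fin.ofNat 16 s : Fin 16) : ℕ) : ZMod 32) := by
    decide +kernel
  have h3 := h2 ⟨s, hs⟩
  dsimp only at h3
  rw [bellCoeff, h, h3]
  push_cast
  ring

theorem bellValue_ghzBell (r : Tensor 16) :
    bellValue ghzBell r = (∑ x : Fin 16, ∑ y : Fin 16, ∑ z : Fin 16,
      (profile (((x : ℕ) : ZMod 32) + ((y : ℕ) : ZMod 32) + ((z : ℕ) : ZMod 32)) : ℝ) *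
        r (some x) (some y) (some z)) / 2000797767168 := by
  simp only [bellValue, Fintype.sum_option, ghzBell, zero_mul, Finset.sum_const_zero, zero_add]
  simp only [Finset.sum_div]
  refine Finset.sum_congr rfl fun x _ => Finset.sum_congr rfl fun y _ =>
    Finset.sum_congr rfl fun z _ => ?_
  rw [bellCoeff_eq (by omega)]
  push_cast
  ring

/-! ### Deterministic strategies from sign sequences -/

/-- A sequence on `ZMod 32` as the response of one party. -/
def seqResponse (A : ZMod 32 → ℤ) : Option (Fin 16) → ℝ
  | none => 1
  | some x => A ((x : ℕ) : ZMod 32)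

/-- The strategy in which the parties respond with the given sequences. -/
def seqTensor (A B C : ZMod 32 → ℤ) : Tensor 16 :=
  fun i j k => seqResponse A i * seqResponse B j * seqResponse C k

theorem IsSignSeq.exists_response {A : ZMod 32 → ℤ} (hA : IsSignSeq A) :
    ∃ a : Fin 16 → ℤˣ, response a = seqResponse A := by
  have h : ∀ x, ∃ u : ℤˣ, (u : ℤ) = A x := fun x => by
    rcases hA.unit x with h | h
    · exact ⟨1, by rw [h]; rfl⟩
    · exact ⟨-1, by rw [h]; rfl⟩
  choose u hu using h
  refine ⟨fun x => u ((x : ℕ) : ZMod 32), funext fun i => ?_⟩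
  cases i with
  | none => rfl
  | some x => simp [response, seqResponse, hu]

theorem exists_seqResponse (a : Fin 16 → ℤˣ) :
    ∃ A, IsSignSeq A ∧ seqResponse A = response a := by
  refine ⟨fun x => (a ⟨x.val % 16, Nat.mod_lt _ (by norm_num)⟩ : ℤ) *
    (if x.val < 16 then 1 else -1), ⟨fun x => ?_, fun x => ?_⟩, funext fun i => ?_⟩
  · rcases Int.units_eq_one_or (a ⟨x.val % 16, Nat.mod_lt _ (by norm_num)⟩) with h | h <;>
      rw [h] <;> split <;> simp
  · simp only [val_mod_add_sixteen, val_add_sixteen_lt]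
    by_cases h : x.val < 16 <;> simp [h]
  · cases i with
    | none => rfl
    | some x =>
      have h : (((x : ℕ) : ZMod 32)).val = x := ZMod.val_natCast_of_lt (by omega)
      simp [response, seqResponse, h, Nat.mod_eq_of_lt x.2]

theorem seqTensor_mem {A B C : ZMod 32 → ℤ} (hA : IsSignSeq A) (hB : IsSignSeq B)
    (hC : IsSignSeq C) : seqTensor A B C ∈ localPolytope 16 := by
  obtain ⟨a, ha⟩ := hA.exists_response
  obtain ⟨b, hb⟩ := hB.exists_response
  obtain ⟨c, hc⟩ := hC.exists_response
  refine subset_convexHull _ _ ⟨a, b, c, ?_⟩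
  unfold seqTensor detStrategy
  rw [ha, hb, hc]

theorem bellValue_seqTensor {A B C : ZMod 32 → ℤ} (hA : IsSignSeq A) (hB : IsSignSeq B)
    (hC : IsSignSeq C) :
    bellValue ghzBell (seqTensor A B C) = (triForm A B C : ℝ) / (8 * 2000797767168) := by
  rw [bellValue_ghzBell, triForm]
  push_cast
  rw [sum_zmod_periodic_three (ψ := fun x y z => (profile (x + y + z) : ℝ) * A x * B y * C z)]
  · simp only [seqTensor, seqResponse]
    rw [mul_div_mul_left _ _ (by norm_num)]
    congr 1
    exact Finset.sum_congr rfl fun x _ => Finset.sum_congr rfl fun y _ =>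
      Finset.sum_congr rfl fun z _ => by ring
  · intro x y z
    rw [hA.anti, show x + 16 + y + z = x + y + z + 16 by ring, profile_anti]
    push_cast
    ring
  · intro x y z
    rw [hB.anti, show x + (y + 16) + z = x + y + z + 16 by ring, profile_anti]
    push_cast
    ring
  · intro x y z
    rw [hC.anti, ← add_assoc, profile_anti]
    push_cast
    ring

theorem bellValue_detStrategy_le (a b c : Fin 16 → ℤˣ) :
    bellValue ghzBell (detStrategy a b c) ≤ 1 := by
  obtain ⟨A, hA, ha⟩ := exists_seqResponse a
  obtain ⟨B, hB, hb⟩ := exists_seqResponse b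
  obtain ⟨C, hC, hc⟩ := exists_seqResponse c
  have h1 : detStrategy a b c = seqTensor A B C := by
    unfold seqTensor detStrategy
    rw [ha, hb, hc]
  rw [h1, bellValue_seqTensor hA hB hC, div_le_one (by norm_num)]
  exact_mod_cast triForm_le hA hB hC

/-- `codeSeq 0` is the square wave, and `codeSeq 1023` is the same wave delayed by ten steps. -/
theorem triForm_attained : triForm (codeSeq 0) (codeSeq 0) (codeSeq 1023) = 8 * 2000797767168 := by
  rw [triForm_eq (isSignSeq_codeSeq _) (isSignSeq_codeSeq _) (isSignSeq_codeSeq _)]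
  decide +kernel

theorem isLocalBound_ghzBell : IsLocalBound ghzBell 1 := by
  refine ⟨?_, ?_⟩
  · obtain ⟨a, ha⟩ := (isSignSeq_codeSeq 0).exists_response
    obtain ⟨c, hc⟩ := (isSignSeq_codeSeq 1023).exists_response
    refine ⟨a, a, c, ?_⟩
    have h1 : detStrategy a a c = seqTensor (codeSeq 0) (codeSeq 0) (codeSeq 1023) := by
      unfold seqTensor detStrategy
      rw [ha, hc]
    rw [h1, bellValue_seqTensor (isSignSeq_codeSeq _) (isSignSeq_codeSeq _) (isSignSeq_codeSeq _),
      triForm_attained]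
    norm_num
  · rintro _ ⟨a, b, c, rfl⟩
    exact bellValue_detStrategy_le a b c

/-! ### Symmetrisation -/

/-- The tensor without marginals whose three-party entries are `g (x + y + z)`. -/
def symTensor (g : ZMod 32 → ℝ) : Tensor 16
  | none, none, none => 1
  | some x, some y, some z => g (((x : ℕ) : ZMod 32) + ((y : ℕ) : ZMod 32) + ((z : ℕ) : ZMod 32))
  | _, _, _ => 0

/-- The three-party correlations of `seqTensor A B C`, summed over all rotations. -/
def tripleConv (A B C : ZMod 32 → ℤ) (u : ZMod 32) : ℤ := ∑ s, ∑ t, A s * B t * C (u - s - t)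

theorem sum_eq_zero_of_anti {φ : ZMod 32 → ℝ} (h : ∀ x, φ (x + 16) = -φ x) : ∑ x, φ x = 0 := by
  have h1 : ∑ x, φ (x + 16) = ∑ x, φ x :=
    Fintype.sum_equiv (Equiv.addRight (16 : ZMod 32)) _ _ fun _ => rfl
  simp only [h, Finset.sum_neg_distrib] at h1
  linarith

/-- This is the uniform average over the `32 ^ 2` triples of rotations with total zero. If some but
not all parties are left out, a remaining factor can be summed over a whole antiperiodic cycle with
the others fixed, which gives zero. -/
theorem symTensor_tripleConv_mem {A B C : ZMod 32 → ℤ} (hA : IsSignSeq A) (hB : IsSignSeq B)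
    (hC : IsSignSeq C) :
    symTensor (fun u => (tripleConv A B C u : ℝ) / 1024) ∈ localPolytope 16 := by
  have h := (convex_convexHull ℝ {d | ∃ a b c : Fin 16 → ℤˣ, d = detStrategy a b c}).sum_mem
    (t := (Finset.univ : Finset (ZMod 32 × ZMod 32))) (w := fun _ => 1 / 1024)
    (z := fun p => seqTensor (fun x => A (x + p.1)) (fun x => B (x + p.2))
      (fun x => C (x + -(p.1 + p.2))))
    (fun _ _ => by norm_num) (by simp [ZMod.card])
    (fun p _ => seqTensor_mem (hA.shift _) (hB.shift _) (hC.shift _))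
  refine (congrArg (· ∈ localPolytope 16) ?_).mpr h
  funext i j k
  rw [Finset.sum_apply, Finset.sum_apply, Finset.sum_apply, Fintype.sum_prod_type]
  simp only [Pi.smul_apply, smul_eq_mul, ← Finset.mul_sum]
  have hA0 : ∀ x, ∑ s, (A (x + s) : ℝ) = 0 := fun x =>
    sum_eq_zero_of_anti fun s => by rw [← add_assoc, hA.anti, Int.cast_neg]
  have hB0 : ∀ x, ∑ s, (B (x + s) : ℝ) = 0 := fun x =>
    sum_eq_zero_of_anti fun s => by rw [← add_assoc, hB.anti, Int.cast_neg]
  have hC0 : ∀ x s, ∑ t, (C (x + -(s + t)) : ℝ) = 0 := fun x s =>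
    sum_eq_zero_of_anti fun t => by
      rw [show x + -(s + (t + 16)) = x + -(s + t) + -16 by ring, show (-16 : ZMod 32) = 16 by rfl,
        hC.anti, Int.cast_neg]
  have hC1 : ∀ x t, ∑ s, (C (x + -(s + t)) : ℝ) = 0 := fun x t => by
    simp only [add_comm _ t, hC0]
  rcases i with _ | x <;> rcases j with _ | y <;> rcases k with _ | z <;>
    simp only [symTensor, seqTensor, seqResponse, one_mul, mul_one, ← Finset.mul_sum,
      hB0, hC0, mul_zero, Finset.sum_const_zero]
  · simp [ZMod.card]
    norm_num
  · rw [Finset.sum_comm]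
    simp only [← Finset.mul_sum, hC1, Finset.sum_const_zero, mul_zero]
  · rw [Finset.sum_comm]
    simp only [hA0, Finset.sum_const_zero, mul_zero]
  · rw [tripleConv, one_div, inv_mul_eq_div]
    congr 1
    push_cast
    symm
    refine Fintype.sum_equiv (Equiv.addLeft ((x : ℕ) : ZMod 32)) _ _ fun s => ?_
    refine Fintype.sum_equiv (Equiv.addLeft ((y : ℕ) : ZMod 32)) _ _ fun t => ?_
    simp only [Equiv.coe_addLeft]
    congr 3
    ring

/-- The three-party correlations of `seqTensor A B C`, averaged over rotations and reflections. -/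
noncomputable def symProfile (A B C : ZMod 32 → ℤ) (u : ZMod 32) : ℝ :=
  ((tripleConv A B C u : ℝ) + tripleConv A B C (-u)) / 2048

theorem symTensor_symProfile_mem {A B C : ZMod 32 → ℤ} (hA : IsSignSeq A) (hB : IsSignSeq B)
    (hC : IsSignSeq C) : symTensor (symProfile A B C) ∈ localPolytope 16 := by
  have hneg : ∀ {A}, IsSignSeq A → IsSignSeq fun x => A (-x) := fun h =>
    ⟨fun x => h.unit _, fun x => by
      rw [neg_add, show (-16 : ZMod 32) = 16 by rfl, h.anti]⟩
  have h1 := symTensor_tripleConv_mem hA hB hC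
  have h2 := symTensor_tripleConv_mem (hneg hA) (hneg hB) (hneg hC)
  have h3 : ∀ u, tripleConv (fun x => A (-x)) (fun x => B (-x)) (fun x => C (-x)) u =
      tripleConv A B C (-u) := by
    intro u
    refine Fintype.sum_equiv (Equiv.neg _) _ _ fun s => ?_
    refine Fintype.sum_equiv (Equiv.neg _) _ _ fun t => ?_
    simp only [Equiv.neg_apply]
    congr 2
    ring
  have h := (convex_convexHull ℝ {d | ∃ a b c : Fin 16 → ℤˣ, d = detStrategy a b c}) h1 h2
    (a := 1 / 2) (b := 1 / 2) (by norm_num) (by norm_num) (by norm_num)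
  refine (congrArg (· ∈ localPolytope 16) ?_).mpr h
  funext i j k
  rcases i with _ | x <;> rcases j with _ | y <;> rcases k with _ | z <;>
    simp only [symTensor, Pi.add_apply, Pi.smul_apply, smul_eq_mul, symProfile, h3] <;> ring

theorem tripleConv_anti {A B C : ZMod 32 → ℤ} (hC : IsSignSeq C) (u : ZMod 32) :
    tripleConv A B C (u + 16) = -tripleConv A B C u := by
  unfold tripleConv
  rw [← Finset.sum_neg_distrib]
  refine Finset.sum_congr rfl fun s _ => ?_
  rw [← Finset.sum_neg_distrib]
  refine Finset.sum_congr rfl fun t _ => ?_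
  rw [show u + 16 - s - t = u - s - t + 16 by ring, hC.anti]
  ring

/-- Even functions on `ZMod 32` that change sign when the argument is increased by 16. -/
structure IsEvenAnti (g : ZMod 32 → ℝ) : Prop where
  even : ∀ x, g (-x) = g x
  anti : ∀ x, g (x + 16) = -g x

theorem isEvenAnti_symProfile {A B C : ZMod 32 → ℤ} (hC : IsSignSeq C) :
    IsEvenAnti (symProfile A B C) := by
  constructor
  · intro x
    rw [symProfile, symProfile, neg_neg, add_comm]
  · intro x
    rw [symProfile, symProfile, neg_add, show (-16 : ZMod 32) = 16 by rfl, tripleConv_anti hC,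
      tripleConv_anti hC]
    push_cast
    ring

/-- Evenness and antiperiodicity fold the circle onto `0, …, 8`, and force the value at 8 to vanish
because `-8 + 16 = 8`. -/
theorem IsEvenAnti.ext {g h : ZMod 32 → ℝ} (hg : IsEvenAnti g) (hh : IsEvenAnti h)
    (H : ∀ u : Fin 8, g ((u : ℕ) : ZMod 32) = h ((u : ℕ) : ZMod 32)) : g = h := by
  have key : ∀ x : ZMod 32, x = 8 ∨ x = 8 + 16 ∨ (∃ u : Fin 8, x = ((u : ℕ) : ZMod 32)) ∨
      (∃ u : Fin 8, x = ((u : ℕ) : ZMod 32) + 16) ∨ (∃ u : Fin 8, x = -((u : ℕ) : ZMod 32)) ∨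
      ∃ u : Fin 8, x = -((u : ℕ) : ZMod 32) + 16 := by decide
  have h8 : ∀ {g}, IsEvenAnti g → g 8 = 0 := fun {g} hg => by
    have h1 := hg.anti (-8)
    rw [hg.even, show (-8 + 16 : ZMod 32) = 8 by rfl] at h1
    linarith
  funext x
  rcases key x with rfl | rfl | ⟨u, rfl⟩ | ⟨u, rfl⟩ | ⟨u, rfl⟩ | ⟨u, rfl⟩
  · rw [h8 hg, h8 hh]
  · rw [hg.anti, hh.anti, h8 hg, h8 hh]
  · exact H u
  · rw [hg.anti, hh.anti, H]
  · rw [hg.even, hh.even, H]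
  · rw [hg.anti, hh.anti, hg.even, hh.even, H]


/-! ### The vertices of the symmetrised facet -/

theorem tripleConv_eq {A B C : ZMod 32 → ℤ} (hA : IsSignSeq A) (hB : IsSignSeq B)
    (hC : IsSignSeq C) (u : ZMod 32) :
    tripleConv A B C u = 4 * ∑ s ∈ Finset.range 16, ∑ t ∈ Finset.range 16,
      A s * B t * C (u - s - t) := by
  have hC' : ∀ x, C (x - 16) = -C x := fun x => by
    rw [sub_eq_add_neg, show (-16 : ZMod 32) = 16 by rfl, hC.anti]
  have h2 : ∀ s, ∑ t, A s * B t * C (u - s - t) =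
      2 * ∑ t ∈ Finset.range 16, A s * B t * C (u - s - t) := fun s => by
    rw [sum_zmod_periodic, two_nsmul, two_mul]
    intro t
    rw [hB.anti, sub_add_eq_sub_sub, hC']
    ring
  rw [tripleConv]
  simp_rw [h2]
  rw [sum_zmod_periodic, two_nsmul, ← Finset.mul_sum]
  · ring
  · intro s
    congr 1
    refine Finset.sum_congr rfl fun t _ => ?_
    rw [hA.anti, show u - (s + 16) - t = u - s - t - 16 by ring, hC']
    ring

/-- Multiplication by a unit permutes the summation variables. Hence one tabulated convolution
yields those of all eight vertices. -/
theorem tripleConv_comp_mul {A B C : ZMod 32 → ℤ} {k l : ZMod 32} (hkl : k * l = 1)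
    (c u : ZMod 32) :
    tripleConv (fun x => A (k * x)) (fun x => B (k * x)) (fun x => C (k * x + c)) u =
      tripleConv A B C (k * u + c) := by
  let e : ZMod 32 ≃ ZMod 32 := ⟨fun x => k * x, fun x => l * x,
    fun x => by linear_combination x * hkl, fun x => by linear_combination x * hkl⟩
  refine Fintype.sum_equiv e _ _ fun s => Fintype.sum_equiv e _ _ fun t => ?_
  change _ = A (k * s) * B (k * t) * C (k * u + c - k * s - k * t)
  dsimp only
  rw [show k * (u - s - t) + c = k * u + c - k * s - k * t by ring]

/-- The multiples by which the square wave is stretched to get the vertices. -/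
def stretch : Fin 8 → ZMod 32 := ![1, 3, 5, 7, 11, 9, 13, 15]

def stretchInv : Fin 8 → ZMod 32 := ![1, 11, 13, 23, 3, 25, 5, 15]

/-- The shifts that fix the signs of the vertices. -/
def stretchShift : Fin 8 → ZMod 32 := ![0, 0, 16, 0, 0, 0, 16, 16]

theorem isSignSeq_stretch {A : ZMod 32 → ℤ} (hA : IsSignSeq A) (i : Fin 8) (c : ZMod 32) :
    IsSignSeq fun x => A (stretch i * x + c) := by
  refine ⟨fun x => hA.unit _, fun x => ?_⟩
  have h : ∀ i, stretch i * 16 = 16 := by decide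
  rw [mul_add, h, add_right_comm, hA.anti]

/-- The symmetrised correlations of the vertices of the facet. -/
noncomputable def vertexProfile (i : Fin 8) : ZMod 32 → ℝ :=
  symProfile (fun x => codeSeq 0 (stretch i * x)) (fun x => codeSeq 0 (stretch i * x))
    (fun x => codeSeq 1023 (stretch i * x + stretchShift i))

theorem isEvenAnti_vertexProfile (i : Fin 8) : IsEvenAnti (vertexProfile i) :=
  isEvenAnti_symProfile (isSignSeq_stretch (isSignSeq_codeSeq _) i _)

theorem symTensor_vertexProfile_mem (i : Fin 8) :
    symTensor (vertexProfile i) ∈ localPolytope 16 := by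
  have h := isSignSeq_stretch (isSignSeq_codeSeq 0) i 0
  simp only [add_zero] at h
  exact symTensor_symProfile_mem h h (isSignSeq_stretch (isSignSeq_codeSeq _) i _)

/-- The autocorrelation of third order of the square wave. -/
def waveTable (s : ZMod 32) : ℤ :=
  ([256, 252, 240, 220, 192, 156, 112, 60, 0, -60, -112, -156, -192, -220, -240, -252, -256, -252, -240, -220, -192, -156, -112, -60, 0, 60, 112, 156, 192, 220, 240, 252] : List ℤ).getD s.val 0

theorem symProfile_wave :
    symProfile (codeSeq 0) (codeSeq 0) (codeSeq 1023) = fun u => (waveTable u : ℝ) / 512 := by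
  refine IsEvenAnti.ext (isEvenAnti_symProfile (isSignSeq_codeSeq _)) ⟨fun x => ?_, fun x => ?_⟩
    fun u => ?_
  · have h : ∀ x, waveTable (-x) = waveTable x := by decide
    rw [h]
  · have h : ∀ x, waveTable (x + 16) = -waveTable x := by decide
    rw [h]
    push_cast
    ring
  · have h : ∀ u : Fin 8,
        (∑ s ∈ Finset.range 16, ∑ t ∈ Finset.range 16,
          codeSeq 0 s * codeSeq 0 t * codeSeq 1023 (((u : ℕ) : ZMod 32) - s - t)) +
        (∑ s ∈ Finset.range 16, ∑ t ∈ Finset.range 16,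
          codeSeq 0 s * codeSeq 0 t * codeSeq 1023 (-((u : ℕ) : ZMod 32) - s - t)) =
        waveTable ((u : ℕ) : ZMod 32) := by
      decide +kernel
    have hs := isSignSeq_codeSeq
    rw [symProfile, ← Int.cast_add, tripleConv_eq (hs _) (hs _) (hs _),
      tripleConv_eq (hs _) (hs _) (hs _), ← mul_add, h]
    push_cast
    ring

def vertexTable : Fin 8 → Fin 8 → ℤ :=
  ![![256, 252, 240, 220, 192, 156, 112, 60],
    ![256, 220, 112, -60, -192, -252, -240, -156],
    ![-256, -156, 112, 252, 192, -60, -240, -220],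
    ![256, 60, -240, -156, 192, 220, -112, -252],
    ![256, -156, -112, 252, -192, -60, 240, -220],
    ![256, -60, -240, 156, 192, -220, -112, 252],
    ![-256, 220, -112, -60, 192, -252, 240, -156],
    ![-256, 252, -240, 220, -192, 156, -112, 60]]

theorem vertexProfile_apply (i u : Fin 8) :
    vertexProfile i ((u : ℕ) : ZMod 32) = (vertexTable i u : ℝ) / 512 := by
  have h1 : ∀ i, stretch i * stretchInv i = 1 := by decide
  have h2 : ∀ i, stretchShift i = -stretchShift i := by decide
  have h3 : ∀ i u : Fin 8, waveTable (stretch i * ((u : ℕ) : ZMod 32) + stretchShift i) =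
      vertexTable i u := by decide
  have h4 := congrFun symProfile_wave (stretch i * ((u : ℕ) : ZMod 32) + stretchShift i)
  rw [h3, symProfile] at h4
  rw [vertexProfile, symProfile, tripleConv_comp_mul (h1 i), tripleConv_comp_mul (h1 i), ← h4]
  congr 4
  rw [neg_add, ← h2, mul_neg]

/-! ### Coordinates with respect to the vertices -/

/-- The inverse of the matrix of the vertices. -/
noncomputable def weightTable : Fin 8 → Fin 8 → ℝ :=
  ![![1 / 4, 4456416 / 9508049, 60 / 137, 3999968 / 9508049, 1 / 3, 2476032 / 9508049, 28 / 137, 746496 / 9508049],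
    ![1 / 4, 3999968 / 9508049, 28 / 137, -746496 / 9508049, -1 / 3, -4456416 / 9508049, -60 / 137, -2476032 / 9508049],
    ![-1 / 4, -2476032 / 9508049, 28 / 137, 4456416 / 9508049, 1 / 3, -746496 / 9508049, -60 / 137, -3999968 / 9508049],
    ![1 / 4, 746496 / 9508049, -60 / 137, -2476032 / 9508049, 1 / 3, 3999968 / 9508049, -28 / 137, -4456416 / 9508049],
    ![1 / 4, -2476032 / 9508049, -28 / 137, 4456416 / 9508049, -1 / 3, -746496 / 9508049, 60 / 137, -3999968 / 9508049],
    ![1 / 4, -746496 / 9508049, -60 / 137, 2476032 / 9508049, 1 / 3, -3999968 / 9508049, -28 / 137, 4456416 / 9508049],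
    ![-1 / 4, 3999968 / 9508049, -28 / 137, -746496 / 9508049, 1 / 3, -4456416 / 9508049, 60 / 137, -2476032 / 9508049],
    ![-1 / 4, 4456416 / 9508049, -60 / 137, 3999968 / 9508049, -1 / 3, 2476032 / 9508049, -28 / 137, 746496 / 9508049]]

/-- The coordinates of an even antiperiodic function with respect to the vertices. -/
noncomputable def vertexWeight (g : ZMod 32 → ℝ) (i : Fin 8) : ℝ :=
  ∑ u : Fin 8, weightTable i u * g ((u : ℕ) : ZMod 32)

theorem sum_weightTable_mul_vertexTable (u v : Fin 8) :
    ∑ i, weightTable i u * vertexTable i v = if u = v then 512 else 0 := by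
  fin_cases u <;> fin_cases v <;>
    simp [Fin.sum_univ_eight, weightTable, vertexTable] <;> norm_num

theorem sum_vertexWeight_mul {g : ZMod 32 → ℝ} (hg : IsEvenAnti g) :
    (fun x => ∑ i, vertexWeight g i * vertexProfile i x) = g := by
  refine IsEvenAnti.ext ⟨fun x => ?_, fun x => ?_⟩ hg fun v => ?_
  · simp only [(isEvenAnti_vertexProfile _).even]
  · simp only [(isEvenAnti_vertexProfile _).anti, mul_neg, Finset.sum_neg_distrib]
  · have h : ∀ i, vertexWeight g i * vertexProfile i ((v : ℕ) : ZMod 32) =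
        ∑ u : Fin 8, weightTable i u * vertexTable i v * (g ((u : ℕ) : ZMod 32) / 512) := by
      intro i
      rw [vertexProfile_apply, vertexWeight, Finset.sum_mul]
      exact Finset.sum_congr rfl fun u _ => by ring
    rw [Finset.sum_congr rfl fun i _ => h i, Finset.sum_comm]
    simp_rw [← Finset.sum_mul, sum_weightTable_mul_vertexTable]
    simp
    ring

theorem symTensor_eq_noise_add {g : ZMod 32 → ℝ} (hg : IsEvenAnti g) :
    symTensor g = symTensor 0 +
      ∑ i, vertexWeight g i • (symTensor (vertexProfile i) - symTensor 0) := by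
  have h := sum_vertexWeight_mul hg
  funext i j k
  simp only [Pi.add_apply, Finset.sum_apply, Pi.smul_apply, Pi.sub_apply, smul_eq_mul]
  rcases i with _ | x <;> rcases j with _ | y <;> rcases k with _ | z <;> simp [symTensor]
  exact (congrFun h _).symm

/-- The column sums of `weightTable` are the numbers `512 f(u)`, halved for `u = 0`: in the sum over
the circle, `0` stands for two arguments and each of `1, …, 7` for four. -/
theorem bellValue_symTensor {g : ZMod 32 → ℝ} (hg : IsEvenAnti g) :
    bellValue ghzBell (symTensor g) = ∑ i, vertexWeight g i := by
  have hp : ∀ x, (profile (x + 16) : ℝ) * g (x + 16) = profile x * g x := fun x => by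
    rw [profile_anti, hg.anti]
    push_cast
    ring
  have hs : ∀ x, (profile (16 - x) : ℝ) * g (16 - x) = profile x * g x := fun x => by
    rw [sub_eq_neg_add, hp, profile_even, hg.even]
  have h1 := sum_zmod_periodic_three
    (ψ := fun x y z => (profile (x + y + z) : ℝ) * g (x + y + z))
    (fun x y z => by rw [show x + 16 + y + z = x + y + z + 16 by ring, hp])
    (fun x y z => by rw [show x + (y + 16) + z = x + y + z + 16 by ring, hp])
    (fun x y z => by rw [← add_assoc, hp])
  have h2 : ∀ x y : ZMod 32, ∑ z, (profile (x + y + z) : ℝ) * g (x + y + z) =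
      ∑ u, (profile u : ℝ) * g u := fun x y =>
    Fintype.sum_equiv (Equiv.addLeft (x + y)) _ _ fun _ => rfl
  simp_rw [h2] at h1
  rw [sum_zmod_periodic (φ := fun u => (profile u : ℝ) * g u) hp] at h1
  simp only [Finset.sum_const, Finset.card_univ, ZMod.card, nsmul_eq_mul, Finset.sum_range_succ,
    Finset.sum_range_zero, zero_add, Nat.cast_ofNat, Nat.cast_zero, Nat.cast_one] at h1
  have e8 : profile 8 = 0 := by decide
  rw [bellValue_ghzBell]
  simp only [symTensor]
  rw [eq_div_of_mul_eq (by norm_num) ((mul_comm _ _).trans h1.symm)]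
  rw [show (15 : ZMod 32) = 16 - 1 by decide, show (14 : ZMod 32) = 16 - 2 by decide,
    show (13 : ZMod 32) = 16 - 3 by decide, show (12 : ZMod 32) = 16 - 4 by decide,
    show (11 : ZMod 32) = 16 - 5 by decide, show (10 : ZMod 32) = 16 - 6 by decide,
    show (9 : ZMod 32) = 16 - 7 by decide, hs, hs, hs, hs, hs, hs, hs, e8,
    show profile 0 = 3907808139 by decide, show profile 1 = 4915849344 by decide,
    show profile 2 = -3422897640 by decide, show profile 3 = 6337527936 by decide,
    show profile 4 = 2605205426 by decide, show profile 5 = -2241495360 by decide,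
    show profile 6 = -1597352232 by decide, show profile 7 = -4709652288 by decide]
  simp only [vertexWeight, Fin.sum_univ_eight, weightTable, Matrix.cons_val]
  simp only [Fin.isValue, Fin.val_zero, Fin.val_one, Fin.val_two, show ((3 : Fin 8) : ℕ) = 3 from rfl,
    show ((4 : Fin 8) : ℕ) = 4 from rfl, show ((5 : Fin 8) : ℕ) = 5 from rfl,
    show ((6 : Fin 8) : ℕ) = 6 from rfl, show ((7 : Fin 8) : ℕ) = 7 from rfl]
  push_cast
  ring


/-! ### Facets -/

/-- If `P` spans no more than a point `e` and a set `T` that lies in a hyperplane off `e`, then the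
dimension of `T` is one less than that of `P`. -/
theorem finrank_vectorSpan_add_one {V : Type*} [AddCommGroup V] [Module ℝ V]
    [FiniteDimensional ℝ V] {P T : Set V} {e : V} (φ : V →ₗ[ℝ] ℝ) (he : e ∈ P) (hTP : T ⊆ P)
    (hφe : φ e = 0) (hφT : ∀ t ∈ T, φ t = 1) (hT : T.Nonempty)
    (hspan : ∀ p ∈ P, p - e ∈ Submodule.span ℝ ((· - e) '' T)) :
    Module.finrank ℝ (vectorSpan ℝ T) + 1 = Module.finrank ℝ (vectorSpan ℝ P) := by
  obtain ⟨t, ht⟩ := hT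
  -- The directions of `T` lie in the kernel of `φ`, while `φ (t - e) = 1`. So the line through `t -
  -- e` complements them, and together they give all directions of `P`.
  have hker : vectorSpan ℝ T ≤ LinearMap.ker φ := by
    rw [vectorSpan_eq_span_vsub_set_right ℝ ht, Submodule.span_le]
    rintro _ ⟨s, hs, rfl⟩
    simp [hφT s hs, hφT t ht]
  have hne : t - e ≠ 0 := fun h => by
    have := congrArg φ h
    rw [map_sub, hφT t ht, hφe, map_zero] at this
    norm_num at this
  have hinf : vectorSpan ℝ T ⊓ Submodule.span ℝ {t - e} = ⊥ := by
    rw [eq_bot_iff]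
    rintro x ⟨hx1, hx2⟩
    obtain ⟨c, rfl⟩ := Submodule.mem_span_singleton.1 hx2
    have h1 : φ (c • (t - e)) = 0 := hker hx1
    rw [map_smul, map_sub, hφT t ht, hφe, smul_eq_mul, sub_zero, mul_one] at h1
    simp [h1]
  have hsup : vectorSpan ℝ T ⊔ Submodule.span ℝ {t - e} = vectorSpan ℝ P := by
    apply le_antisymm
    · refine sup_le (vectorSpan_mono ℝ hTP) ?_
      rw [Submodule.span_singleton_le_iff_mem]
      exact vsub_mem_vectorSpan ℝ (hTP ht) he
    · rw [vectorSpan_eq_span_vsub_set_right ℝ he, Submodule.span_le]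
      rintro _ ⟨p, hp, rfl⟩
      refine (Submodule.span_le.2 ?_ : Submodule.span ℝ ((· - e) '' T) ≤ _) (hspan p hp)
      rintro _ ⟨s, hs, rfl⟩
      have h1 : s - e = (s - t) + (t - e) := by abel
      dsimp only
      rw [h1]
      exact Submodule.add_mem_sup (vsub_mem_vectorSpan ℝ hs ht) (Submodule.mem_span_singleton_self _)
  have h := Submodule.finrank_sup_add_finrank_inf_eq (vectorSpan ℝ T)
    (Submodule.span ℝ {t - e})
  rw [hinf, hsup, finrank_bot, finrank_span_singleton hne] at h
  omega

/-- A valid inequality for finitely many points can be rotated, such that tight points stay tight,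
until its tight points span everything. -/
theorem exists_functional_maximal_tight {V ι : Type*} [AddCommGroup V] [Module ℝ V] [Fintype ι]
    {d : ι → V} {e : V} (τ φ : V →ₗ[ℝ] ℝ) (hτd : ∀ i, τ (d i) = 1) (hτe : τ e = 1)
    (hsum : ∑ i, (d i - e) = 0) (hφe : φ e = 0) (hφ : ∀ i, φ (d i) ≤ 1) :
    ∃ ψ : V →ₗ[ℝ] ℝ, ψ e = 0 ∧ (∀ i, ψ (d i) ≤ 1) ∧ (∀ i, φ (d i) = 1 → ψ (d i) = 1) ∧
      ∀ i, d i - e ∈ Submodule.span ℝ ((fun j => d j - e) '' {j | ψ (d j) = 1}) := by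
  classical
  let S : Set ℕ := {n | ∃ ψ : V →ₗ[ℝ] ℝ, ψ e = 0 ∧ (∀ i, ψ (d i) ≤ 1) ∧
    (∀ i, φ (d i) = 1 → ψ (d i) = 1) ∧ n = (Finset.univ.filter fun j => ψ (d j) = 1).card}
  have hS : S.Nonempty := ⟨_, φ, hφe, hφ, fun _ h => h, rfl⟩
  have hSb : BddAbove S := ⟨Fintype.card ι, by
    rintro _ ⟨ψ, -, -, -, rfl⟩
    exact Finset.card_le_univ _⟩
  -- Among the admissible functionals, one with the most tight points is taken; a missing direction
  -- will produce one with more.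
  obtain ⟨ψ, hψe, hψ, hφψ, hcard⟩ := Nat.sSup_mem hS hSb
  refine ⟨ψ, hψe, hψ, hφψ, fun i₀ => ?_⟩
  by_contra hi₀
  obtain ⟨N₀, hN₀, hN₀'⟩ := Submodule.exists_le_ker_of_notMem hi₀
  -- Subtracting a multiple of the normalisation `τ` makes the functional vanish at `e` and leaves
  -- its values on the differences `d i - e` unchanged.
  let N : V →ₗ[ℝ] ℝ := N₀ - N₀ e • τ
  have hN : ∀ i, N (d i) = N₀ (d i - e) := fun i => by simp [N, hτd]
  have hNe : N e = 0 := by simp [N, hτe]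
  have hNt : ∀ j, ψ (d j) = 1 → N (d j) = 0 := fun j hj => by
    rw [hN]
    exact hN₀' (Submodule.subset_span ⟨j, hj, rfl⟩)
  have hNsum : ∑ i, N (d i) = 0 := by
    simp_rw [hN]
    rw [← map_sum, hsum, map_zero]
  -- The points average to `e`, so a functional that is nonzero at one of them is positive at
  -- another or the same one. The minimal ratio below is the largest step along `N` that preserves
  -- validity, and it makes `d k` newly tight.
  obtain ⟨i₁, -, hi₁⟩ := Finset.exists_pos_of_sum_zero_of_exists_nonzero _ hNsum
    ⟨i₀, Finset.mem_univ _, by rwa [hN]⟩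
  obtain ⟨k, hk, hmin⟩ := (Finset.univ.filter fun i => 0 < N (d i)).exists_min_image
    (fun i => (1 - ψ (d i)) / N (d i)) ⟨i₁, by simpa using hi₁⟩
  rw [Finset.mem_filter] at hk
  have hk := hk.2
  set t := (1 - ψ (d k)) / N (d k) with ht
  have ht0 : 0 ≤ t := div_nonneg (sub_nonneg.2 (hψ k)) hk.le
  have hχk : (ψ + t • N) (d k) = 1 := by
    simp only [LinearMap.add_apply, LinearMap.smul_apply, smul_eq_mul]
    rw [ht, div_mul_cancel₀ _ hk.ne']
    ring
  have hχt : ∀ j, ψ (d j) = 1 → (ψ + t • N) (d j) = 1 := fun j hj => by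
    simp [hj, hNt j hj]
  have hmem : (Finset.univ.filter fun j => (ψ + t • N) (d j) = 1).card ∈ S := by
    refine ⟨ψ + t • N, by simp [hψe, hNe], fun i => ?_, fun i hi => hχt i (hφψ i hi), rfl⟩
    simp only [LinearMap.add_apply, LinearMap.smul_apply, smul_eq_mul]
    rcases le_or_gt (N (d i)) 0 with hi | hi
    · have := mul_nonpos_of_nonneg_of_nonpos ht0 hi
      linarith [hψ i]
    · have h1 := hmin i (by simpa using hi)
      rw [le_div_iff₀ hi] at h1
      linarith
  have hlt : (Finset.univ.filter fun j => ψ (d j) = 1).card <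
      (Finset.univ.filter fun j => (ψ + t • N) (d j) = 1).card := by
    refine Finset.card_lt_card (Finset.ssubset_iff_of_subset ?_ |>.2 ⟨k, ?_, ?_⟩)
    · intro j hj
      rw [Finset.mem_filter] at hj ⊢
      exact ⟨hj.1, hχt j hj.2⟩
    · simpa using hχk
    · intro h
      rw [Finset.mem_filter] at h
      rw [hNt k h.2] at hk
      exact lt_irrefl _ hk
  have := le_csSup hSb hmem
  omega

theorem map_eq_sum_single {ι W : Type*} [Fintype ι] [DecidableEq ι] [AddCommGroup W] [Module ℝ W]
    (f : (ι → W) →ₗ[ℝ] ℝ) (x : ι → W) :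
    f x = ∑ i, (f ∘ₗ LinearMap.single ℝ (fun _ => W) i) (x i) := by
  conv_lhs => rw [← Finset.univ_sum_single x]
  rw [map_sum]
  rfl

/-- Every linear functional on tensors is a Bell expression. -/
theorem exists_bellValue_eq {m : ℕ} (ψ : Tensor m →ₗ[ℝ] ℝ) :
    ∃ M : Tensor m, ∀ r, bellValue M r = ψ r := by
  refine ⟨fun i j k => ψ (Pi.single i (Pi.single j (Pi.single k 1))), fun r => ?_⟩
  rw [map_eq_sum_single ψ]
  refine Finset.sum_congr rfl fun i _ => ?_
  rw [map_eq_sum_single]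
  refine Finset.sum_congr rfl fun j _ => ?_
  rw [map_eq_sum_single]
  refine Finset.sum_congr rfl fun k _ => ?_
  rw [← mul_one (r i j k), ← smul_eq_mul (r i j k) 1, map_smul, mul_comm, smul_eq_mul, smul_eq_mul,
    mul_one]
  rfl

/-! ### The symmetrised polytope -/

theorem isEvenAnti_zero : IsEvenAnti 0 := ⟨fun _ => rfl, fun _ => by simp⟩

theorem localPolytope_none {m : ℕ} {r : Tensor m} (hr : r ∈ localPolytope m) :
    r none none none = 1 := by
  have hc : Convex ℝ {r : Tensor m | r none none none = 1} :=
    convex_hyperplane (f := fun r : Tensor m => r none none none) ⟨fun _ _ => rfl, fun _ _ => rfl⟩ 1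
  refine convexHull_min ?_ hc hr
  rintro _ ⟨a, b, c, rfl⟩
  simp [detStrategy, response]

theorem isPolygonSymmetric_symTensor {g : ZMod 32 → ℝ} (hg : IsEvenAnti g) :
    IsPolygonSymmetric (symTensor g) := by
  refine ⟨fun i j k h1 h2 => ?_, fun s => g (s : ZMod 32), fun s => ?_, fun s => ?_,
    fun x y z => ?_⟩
  · rcases i with _ | x <;> rcases j with _ | y <;> rcases k with _ | z <;>
      simp_all [symTensor]
  · push_cast
    exact hg.anti _
  · push_cast
    exact hg.even _
  · simp [symTensor]

theorem exists_eq_symTensor {r : Tensor 16} (h0 : r none none none = 1)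
    (hr : IsPolygonSymmetric r) : ∃ g, IsEvenAnti g ∧ r = symTensor g := by
  obtain ⟨hm, g, hanti, heven, hg⟩ := hr
  have hper : Function.Periodic g 32 := fun s => by
    rw [show s + 32 = s + (16 : ℕ) + (16 : ℕ) by push_cast; ring, hanti, hanti, neg_neg]
  have hcast : ∀ s : ℤ, g ((s : ZMod 32).val : ℤ) = g s := fun s => by
    rw [ZMod.val_intCast]
    conv_rhs => rw [← Int.emod_add_mul_ediv s 32, mul_comm]
    exact ((hper.int_mul (s / 32)) _).symm
  have hex : ∀ x : ZMod 32, x = ((x.val : ℤ) : ZMod 32) := fun x => by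
    rw [Int.cast_natCast, ZMod.natCast_zmod_val]
  refine ⟨fun x => g (x.val : ℤ), ⟨fun x => ?_, fun x => ?_⟩, ?_⟩
  · have h1 : -x = ((-(x.val : ℤ) : ℤ) : ZMod 32) := by
      push_cast
      rw [ZMod.natCast_zmod_val]
    rw [h1, hcast, heven]
  · have h1 : x + 16 = (((x.val : ℤ) + (16 : ℕ) : ℤ) : ZMod 32) := by
      push_cast
      rw [ZMod.natCast_zmod_val]
    rw [h1, hcast, hanti]
  · funext i j k
    rcases i with _ | x <;> rcases j with _ | y <;> rcases k with _ | z
    · exact h0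
    all_goals try exact hm _ _ _ (by simp) (by simp)
    rw [hg, symTensor, ← hcast]
    push_cast
    rfl

/-- Shifting the third sequence by 16 flips its sign; mixing a symmetrised strategy with its flipped
version leaves white noise. -/
theorem symTensor_zero_mem : symTensor 0 ∈ localPolytope 16 := by
  have hs := isSignSeq_codeSeq 0
  have h1 := symTensor_symProfile_mem hs hs hs
  have h2 := symTensor_symProfile_mem hs hs (hs.shift 16)
  have h3 : symProfile (codeSeq 0) (codeSeq 0) (fun x => codeSeq 0 (x + 16)) =
      fun x => -symProfile (codeSeq 0) (codeSeq 0) (codeSeq 0) x := by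
    funext u
    simp only [symProfile, tripleConv, hs.anti, mul_neg, Finset.sum_neg_distrib]
    push_cast
    ring
  rw [h3] at h2
  have h := (convex_convexHull ℝ {d | ∃ a b c : Fin 16 → ℤˣ, d = detStrategy a b c}) h1 h2
    (a := 1 / 2) (b := 1 / 2) (by norm_num) (by norm_num) (by norm_num)
  refine (congrArg (· ∈ localPolytope 16) ?_).mpr h
  funext i j k
  rcases i with _ | x <;> rcases j with _ | y <;> rcases k with _ | z <;>
    simp only [symTensor, Pi.add_apply, Pi.smul_apply, smul_eq_mul, Pi.zero_apply] <;> ring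

theorem vertexWeight_vertexProfile_sum (i : Fin 8) : ∑ j, vertexWeight (vertexProfile i) j = 1 := by
  have h : ∀ j, vertexWeight (vertexProfile i) j =
      ∑ u : Fin 8, weightTable j u * vertexTable i u / 512 := fun j =>
    Finset.sum_congr rfl fun u _ => by rw [vertexProfile_apply]; ring
  rw [Finset.sum_congr rfl fun j _ => h j]
  fin_cases i <;> simp [Fin.sum_univ_eight, weightTable, vertexTable] <;> norm_num

theorem bellValue_vertexProfile (i : Fin 8) :
    bellValue ghzBell (symTensor (vertexProfile i)) = 1 := by
  rw [bellValue_symTensor (isEvenAnti_vertexProfile i), vertexWeight_vertexProfile_sum]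

theorem bellValue_noise (M : Tensor 16) : bellValue M (symTensor 0) = M none none none := by
  simp [bellValue, Fintype.sum_option, symTensor]

theorem bellValue_ghzBell_le {r : Tensor 16} (hr : r ∈ localPolytope 16) :
    bellValue ghzBell r ≤ 1 :=
  bellValue_le_of_mem bellValue_detStrategy_le hr

theorem isFacet_symmetrized : IsFacet (symmetrizedLocalPolytope 16) ghzBell 1 := by
  have hv : ∀ i, symTensor (vertexProfile i) ∈
      {r | r ∈ symmetrizedLocalPolytope 16 ∧ bellValue ghzBell r = 1} := fun i =>
    ⟨⟨symTensor_vertexProfile_mem i, isPolygonSymmetric_symTensor (isEvenAnti_vertexProfile i)⟩,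
      bellValue_vertexProfile i⟩
  refine ⟨fun r hr => bellValue_ghzBell_le hr.1, ⟨_, hv 0⟩, ?_⟩
  refine finrank_vectorSpan_add_one (e := symTensor 0) (bellLin ghzBell)
    ⟨symTensor_zero_mem, isPolygonSymmetric_symTensor isEvenAnti_zero⟩ (fun r hr => hr.1)
    (bellValue_noise _) (fun r hr => hr.2) ⟨_, hv 0⟩ fun p hp => ?_
  obtain ⟨g, hg, rfl⟩ := exists_eq_symTensor (localPolytope_none hp.1) hp.2
  rw [symTensor_eq_noise_add hg, add_sub_cancel_left]
  exact Submodule.sum_mem _ fun i _ => Submodule.smul_mem _ _ (Submodule.subset_span ⟨_, hv i, rfl⟩)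

/-! ### A facet of the local polytope -/

theorem sum_response {m : ℕ} (x : Fin m) : ∑ a : Fin m → ℤˣ, response a (some x) = 0 := by
  have h : ∑ a : Fin m → ℤˣ, response (-a) (some x) = ∑ a : Fin m → ℤˣ, response a (some x) :=
    Fintype.sum_equiv (Equiv.neg _) _ _ fun _ => rfl
  have h1 : ∀ a : Fin m → ℤˣ, response (-a) (some x) = -response a (some x) := fun a => by
    simp [response]
  simp only [h1, Finset.sum_neg_distrib] at h
  linarith

theorem sum_detStrategy_sub :
    ∑ p : (Fin 16 → ℤˣ) × (Fin 16 → ℤˣ) × (Fin 16 → ℤˣ),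
      (detStrategy p.1 p.2.1 p.2.2 - symTensor 0) = 0 := by
  have h : ∀ i j k, ∑ p : (Fin 16 → ℤˣ) × (Fin 16 → ℤˣ) × (Fin 16 → ℤˣ),
      response p.1 i * response p.2.1 j * response p.2.2 k =
      (∑ a : Fin 16 → ℤˣ, response a i) * (∑ a : Fin 16 → ℤˣ, response a j) *
        ∑ a : Fin 16 → ℤˣ, response a k := by
    intro i j k
    rw [Fintype.sum_prod_type, Finset.sum_mul, Finset.sum_mul]
    refine Finset.sum_congr rfl fun a _ => ?_
    rw [Fintype.sum_prod_type, mul_assoc, Finset.sum_mul, Finset.mul_sum]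
    refine Finset.sum_congr rfl fun b _ => ?_
    rw [← mul_assoc, Finset.mul_sum]
  funext i j k
  rw [Finset.sum_apply, Finset.sum_apply, Finset.sum_apply]
  simp only [Pi.sub_apply, detStrategy, Finset.sum_sub_distrib, Pi.zero_apply]
  rw [h]
  rcases i with _ | x <;> rcases j with _ | y <;> rcases k with _ | z <;>
    simp only [sum_response, symTensor, mul_zero, zero_mul, Finset.sum_const_zero, sub_zero,
      Pi.zero_apply]
  simp only [response, Finset.sum_const, Finset.card_univ, nsmul_eq_mul, mul_one,
    Fintype.card_prod]
  push_cast
  ring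

theorem exists_facet_localPolytope :
    ∃ M : Tensor 16, M none none none = 0 ∧ IsLocalBound M 1 ∧ IsFacet (localPolytope 16) M 1 ∧
      ∀ g, IsEvenAnti g → bellValue M (symTensor g) = bellValue ghzBell (symTensor g) := by
  let d : (Fin 16 → ℤˣ) × (Fin 16 → ℤˣ) × (Fin 16 → ℤˣ) → Tensor 16 :=
    fun p => detStrategy p.1 p.2.1 p.2.2
  let τ : Tensor 16 →ₗ[ℝ] ℝ := ⟨⟨fun r => r none none none, fun _ _ => rfl⟩, fun _ _ => rfl⟩
  obtain ⟨ψ, hψe, hψ, htight, hspan⟩ := exists_functional_maximal_tight (d := d)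
    (e := symTensor 0) τ (bellLin ghzBell) (fun p => by simp [τ, d, detStrategy, response]) rfl
    sum_detStrategy_sub (bellValue_noise _) (fun p => bellValue_detStrategy_le _ _ _)
  obtain ⟨M, hM⟩ := exists_bellValue_eq ψ
  have hd : ∀ p, d p ∈ localPolytope 16 := fun p => subset_convexHull _ _ ⟨_, _, _, rfl⟩
  have hM0 : M none none none = 0 := by rw [← bellValue_noise M, hM, hψe]
  have hle : ∀ a b c, bellValue M (detStrategy a b c) ≤ 1 := fun a b c => by
    rw [hM]
    exact hψ (a, b, c)
  obtain ⟨⟨a, b, c, habc⟩, -⟩ := isLocalBound_ghzBell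
  have h1 : bellValue M (d (a, b, c)) = 1 := by
    rw [hM]
    exact htight _ habc.symm
  -- Tightness passes from strategies to all local points, because a mixture is tight only if every
  -- contributing strategy is. Convexity of `Q` expresses this.
  have hface : ∀ r ∈ localPolytope 16, bellValue ghzBell r = 1 → bellValue M r = 1 := by
    let Q := {r : Tensor 16 | bellValue ghzBell r ≤ 1 ∧ (bellValue ghzBell r = 1 →
      bellValue M r = 1)}
    have hQ : Convex ℝ Q := by
      intro x hx y hy s t hs ht hst
      have e1 : ∀ M, bellValue M (s • x + t • y) = s * bellValue M x + t * bellValue M y := fun M =>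
        by rw [← bellLin_apply, map_add, map_smul, map_smul]; rfl
      have hx1 := hx.1
      have hy1 := hy.1
      refine ⟨by rw [e1]; nlinarith, fun h => ?_⟩
      rw [e1] at h ⊢
      have h2 : s * (1 - bellValue ghzBell x) = 0 := by nlinarith
      have h3 : t * (1 - bellValue ghzBell y) = 0 := by nlinarith
      have h4 : s * bellValue M x = s := by
        rcases mul_eq_zero.1 h2 with h | h
        · rw [h, zero_mul]
        · rw [hx.2 (by linarith), mul_one]
      have h5 : t * bellValue M y = t := by
        rcases mul_eq_zero.1 h3 with h | h
        · rw [h, zero_mul]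
        · rw [hy.2 (by linarith), mul_one]
      rw [h4, h5, hst]
    intro r hr
    refine (convexHull_min ?_ hQ hr).2
    rintro _ ⟨a, b, c, rfl⟩
    refine ⟨bellValue_detStrategy_le a b c, fun h => ?_⟩
    rw [hM]
    exact htight (a, b, c) h
  refine ⟨M, hM0, ⟨⟨a, b, c, h1.symm⟩, ?_⟩, ⟨fun r hr => bellValue_le_of_mem hle hr,
    ⟨_, hd (a, b, c), h1⟩, ?_⟩, fun g hg => ?_⟩
  · rintro _ ⟨a, b, c, rfl⟩
    exact hle a b c
  · refine finrank_vectorSpan_add_one (e := symTensor 0) (bellLin M) symTensor_zero_mem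
      (fun r hr => hr.1) (by rw [bellLin_apply, hM, hψe]) (fun r hr => hr.2)
      ⟨_, hd (a, b, c), h1⟩ fun p hp => ?_
    have hsub : ∀ p, d p - symTensor 0 ∈ Submodule.span ℝ
        ((· - symTensor 0) '' {r | r ∈ localPolytope 16 ∧ bellValue M r = 1}) := fun p => by
      refine Submodule.span_mono ?_ (hspan p)
      rintro _ ⟨q, hq, rfl⟩
      exact ⟨d q, ⟨hd q, by rw [hM]; exact hq⟩, rfl⟩
    generalize Submodule.span ℝ
      ((· - symTensor 0) '' {r | r ∈ localPolytope 16 ∧ bellValue M r = 1}) = U at hsub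
    have hc : Convex ℝ {r : Tensor 16 | r - symTensor 0 ∈ U} := by
      intro x hx y hy s t hs ht hst
      have h2 : s • x + t • y - symTensor 0 = s • (x - symTensor 0) + t • (y - symTensor 0) := by
        rw [smul_sub, smul_sub, sub_add_sub_comm, ← add_smul, hst, one_smul]
      change s • x + t • y - symTensor 0 ∈ U
      rw [h2]
      exact U.add_mem (U.smul_mem s hx) (U.smul_mem t hy)
    refine convexHull_min ?_ hc hp
    rintro _ ⟨a, b, c, rfl⟩
    exact hsub (a, b, c)
  -- Both expressions are 0 on noise and 1 on the eight vertices, and symmetric tensors are affine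
  -- combinations of these nine points.
  · rw [bellValue_symTensor hg, symTensor_eq_noise_add hg, ← bellLin_apply, map_add, map_sum]
    simp only [map_smul, map_sub, bellLin_apply, bellValue_noise, hM0,
      hface _ (symTensor_vertexProfile_mem _) (bellValue_vertexProfile _), smul_eq_mul]
    simp


/-! ### Quantum correlations -/

theorem trace_kronecker_mul_ghzState (v : ℝ) (A B C : Qubit) :
    ((A ⊗ₖ (B ⊗ₖ C)) * ghzState v).trace =
      v / 2 * (A 0 0 * B 0 0 * C 0 0 + A 0 1 * B 0 1 * C 0 1 + A 1 0 * B 1 0 * C 1 0 +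
        A 1 1 * B 1 1 * C 1 1) + (1 - v) / 8 * (A.trace * B.trace * C.trace) := by
  have h2 : ((Real.sqrt 2 : ℝ) : ℂ)⁻¹ * ((Real.sqrt 2 : ℝ) : ℂ)⁻¹ = 1 / 2 := by
    rw [← mul_inv, ← Complex.ofReal_mul, Real.mul_self_sqrt (by norm_num)]
    norm_num
  have h1 : ((A ⊗ₖ (B ⊗ₖ C)) * Matrix.vecMulVec ghzVector (star ghzVector)).trace =
      1 / 2 * (A 0 0 * B 0 0 * C 0 0 + A 0 1 * B 0 1 * C 0 1 + A 1 0 * B 1 0 * C 1 0 +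
        A 1 1 * B 1 1 * C 1 1) := by
    rw [Matrix.mul_vecMulVec, Matrix.trace_vecMulVec, ← h2]
    simp [dotProduct, Matrix.mulVec, Fintype.sum_prod_type, Fin.sum_univ_two, ghzVector,
      Pi.single_apply]
    ring
  rw [ghzState, mul_add, Matrix.trace_add, Matrix.mul_smul, Matrix.mul_smul, Matrix.trace_smul,
    Matrix.trace_smul, h1, mul_one, Matrix.trace_kronecker, Matrix.trace_kronecker]
  simp only [smul_eq_mul]
  push_cast
  ring

theorem polygonObservable_eq (m : ℕ) (x : Fin m) :
    polygonObservable m x =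
      !![0, Complex.exp (-(((x : ℕ) * Real.pi / m : ℝ) * Complex.I));
        Complex.exp (((x : ℕ) * Real.pi / m : ℝ) * Complex.I), 0] := by
  rw [polygonObservable, ← neg_mul, Complex.exp_mul_I, Complex.exp_mul_I, Complex.cos_neg,
    Complex.sin_neg, Complex.ofReal_cos, Complex.ofReal_sin]
  ext i j
  fin_cases i <;> fin_cases j <;> simp [pauliX, pauliY]

theorem isObservable_polygonObservable (m : ℕ) (x : Fin m) :
    IsObservable (polygonObservable m x) := by
  rw [polygonObservable_eq]
  refine ⟨?_, ?_, ?_⟩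
  · ext i j
    fin_cases i <;> fin_cases j <;> simp [← Complex.exp_conj]
  · simp [Matrix.trace_fin_two]
  · rw [Matrix.mul_fin_two, Matrix.one_fin_two]
    simp [← Complex.exp_add]

/-- The function `cos (π x / 16)` on `ZMod 32`. -/
noncomputable def cosProfile (x : ZMod 32) : ℝ := Real.cos (x.val * Real.pi / 16)

theorem cosProfile_intCast (k : ℤ) : cosProfile (k : ZMod 32) = Real.cos (k * Real.pi / 16) := by
  have h : (((k : ZMod 32).val : ℤ) : ℝ) = k - 32 * (k / 32 : ℤ) := by
    rw [ZMod.val_intCast, Int.emod_def]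
    push_cast
    ring
  rw [Int.cast_natCast] at h
  rw [cosProfile, h, ← Real.cos_sub_int_mul_two_pi (k * Real.pi / 16) (k / 32)]
  congr 1
  ring

theorem cosProfile_natCast (k : ℕ) : cosProfile (k : ZMod 32) = Real.cos (k * Real.pi / 16) := by
  exact_mod_cast cosProfile_intCast k

theorem isEvenAnti_cosProfile : IsEvenAnti cosProfile := by
  have hex : ∀ x : ZMod 32, x = ((x.val : ℤ) : ZMod 32) := fun x => by
    rw [Int.cast_natCast, ZMod.natCast_zmod_val]
  refine ⟨fun x => ?_, fun x => ?_⟩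
  · rw [hex x, ← Int.cast_neg, cosProfile_intCast, cosProfile_intCast, ← Real.cos_neg]
    congr 1
    push_cast
    ring
  · rw [hex x, show ((x.val : ℤ) : ZMod 32) + 16 = (((x.val : ℤ) + 16 : ℤ) : ZMod 32) by
      push_cast; rfl, cosProfile_intCast, cosProfile_intCast, ← Real.cos_add_pi]
    congr 1
    push_cast
    ring

/-- The observables have zero diagonal and opposite phases off it. The two surviving GHZ terms are
conjugate exponentials of the summed angles; a mix of observables and identities contributes
nothing. -/
theorem polygonTensor_eq (v : ℝ) :
    polygonTensor 16 v = symTensor fun x => v * cosProfile x := by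
  funext i j k
  rw [polygonTensor, quantumTensor, trace_kronecker_mul_ghzState]
  rcases i with _ | x <;> rcases j with _ | y <;> rcases k with _ | z <;>
    simp only [withIdentity, polygonObservable_eq, symTensor, Matrix.trace_fin_two, Matrix.of_apply,
      Matrix.cons_val', Matrix.cons_val_zero, Matrix.cons_val_one, Matrix.cons_val_fin_one,
      Matrix.one_apply_eq, Matrix.one_apply_ne (show (0 : Fin 2) ≠ 1 by decide),
      Matrix.one_apply_ne (show (1 : Fin 2) ≠ 0 by decide), mul_zero, zero_mul, mul_one,
      add_zero, zero_add, Complex.zero_re]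
  · rw [show (v / 2 * (1 + 1) + (1 - v) / 8 * ((1 + 1) * (1 + 1) * (1 + 1)) : ℂ) = 1 by ring]
    rfl
  · rw [← Nat.cast_add, ← Nat.cast_add, cosProfile_natCast, ← Complex.exp_add, ← Complex.exp_add,
      ← Complex.exp_add, ← Complex.exp_add]
    have h : (v : ℂ) / 2 * (Complex.exp
        (-(((x : ℕ) * Real.pi / (16 : ℕ) : ℝ) * Complex.I) +
          -(((y : ℕ) * Real.pi / (16 : ℕ) : ℝ) * Complex.I) +
          -(((z : ℕ) * Real.pi / (16 : ℕ) : ℝ) * Complex.I)) +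
        Complex.exp ((((x : ℕ) * Real.pi / (16 : ℕ) : ℝ) * Complex.I) +
          (((y : ℕ) * Real.pi / (16 : ℕ) : ℝ) * Complex.I) +
          (((z : ℕ) * Real.pi / (16 : ℕ) : ℝ) * Complex.I))) =
        ((v * Real.cos (((x + y + z : ℕ) : ℝ) * Real.pi / 16) : ℝ) : ℂ) := by
      rw [Complex.ofReal_mul, Complex.ofReal_cos, Complex.cos]
      push_cast
      ring_nf
    rw [h, Complex.ofReal_re]


/-! ### The threshold -/

theorem isEvenAnti_mul (v : ℝ) : IsEvenAnti fun x => v * cosProfile x :=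
  ⟨fun x => by rw [isEvenAnti_cosProfile.even], fun x => by
    rw [isEvenAnti_cosProfile.anti, mul_neg]⟩

theorem vertexWeight_mul (v : ℝ) (g : ZMod 32 → ℝ) (i : Fin 8) :
    vertexWeight (fun x => v * g x) i = v * vertexWeight g i := by
  rw [vertexWeight, vertexWeight, Finset.mul_sum]
  exact Finset.sum_congr rfl fun u _ => by ring

/-- The value of the Bell expression on the noiseless correlations. -/
noncomputable def polygonValue : ℝ := ∑ i, vertexWeight cosProfile i

theorem bellValue_polygonTensor (v : ℝ) :
    bellValue ghzBell (polygonTensor 16 v) = v * polygonValue := by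
  rw [polygonTensor_eq, bellValue_symTensor (isEvenAnti_mul v), polygonValue, Finset.mul_sum]
  exact Finset.sum_congr rfl fun i _ => vertexWeight_mul _ _ _

theorem mul_interval {a b c d x y : ℝ} (ha : 0 ≤ a) (hc : 0 ≤ c) (hx : a ≤ x ∧ x ≤ b)
    (hy : c ≤ y ∧ y ≤ d) : a * c ≤ x * y ∧ x * y ≤ b * d :=
  ⟨mul_le_mul hx.1 hy.1 hc (ha.trans hx.1),
    mul_le_mul hx.2 hy.2 (hc.trans hy.1) (ha.trans (hx.1.trans hx.2))⟩

theorem cos_mul_pi_div_sixteen_bounds :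
    (0.98078528040 ≤ Real.cos (1 * Real.pi / 16) ∧ Real.cos (1 * Real.pi / 16) ≤ 0.98078528041) ∧
    (0.92387953251 ≤ Real.cos (2 * Real.pi / 16) ∧ Real.cos (2 * Real.pi / 16) ≤ 0.92387953252) ∧
    (0.8314696122 ≤ Real.cos (3 * Real.pi / 16) ∧ Real.cos (3 * Real.pi / 16) ≤ 0.8314696124) ∧
    (0.70710678118 ≤ Real.cos (4 * Real.pi / 16) ∧ Real.cos (4 * Real.pi / 16) ≤ 0.70710678119) ∧
    (0.5555702329 ≤ Real.cos (5 * Real.pi / 16) ∧ Real.cos (5 * Real.pi / 16) ≤ 0.5555702332) ∧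
    (0.3826834323 ≤ Real.cos (6 * Real.pi / 16) ∧ Real.cos (6 * Real.pi / 16) ≤ 0.3826834325) ∧
    (0.1950903218 ≤ Real.cos (7 * Real.pi / 16) ∧ Real.cos (7 * Real.pi / 16) ≤ 0.1950903226) := by
  have hprod : ∀ a b : ℝ, Real.cos ((a + b) * Real.pi / 16) =
      2 * (Real.cos (a * Real.pi / 16) * Real.cos (b * Real.pi / 16)) -
        Real.cos ((a - b) * Real.pi / 16) := fun a b => by
    rw [show (a + b) * Real.pi / 16 = a * Real.pi / 16 + b * Real.pi / 16 by ring,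
      show (a - b) * Real.pi / 16 = a * Real.pi / 16 - b * Real.pi / 16 by ring, Real.cos_add,
      Real.cos_sub]
    ring
  have s1 : 1.4142135623730 ≤ Real.sqrt 2 ∧ Real.sqrt 2 ≤ 1.4142135623731 :=
    ⟨Real.le_sqrt_of_sq_le (by norm_num), Real.sqrt_le_iff.2 (by norm_num)⟩
  have s2 : 1.8477590650225 ≤ Real.sqrt (2 + Real.sqrt 2) ∧
      Real.sqrt (2 + Real.sqrt 2) ≤ 1.8477590650227 :=
    ⟨Real.le_sqrt_of_sq_le (by linarith [s1.1]), Real.sqrt_le_iff.2 ⟨by norm_num,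
      by linarith [s1.2]⟩⟩
  have s3 : 1.9615705608064 ≤ Real.sqrt (2 + Real.sqrt (2 + Real.sqrt 2)) ∧
      Real.sqrt (2 + Real.sqrt (2 + Real.sqrt 2)) ≤ 1.9615705608066 :=
    ⟨Real.le_sqrt_of_sq_le (by linarith [s2.1]), Real.sqrt_le_iff.2 ⟨by norm_num,
      by linarith [s2.2]⟩⟩
  have c1 : 0.98078528040 ≤ Real.cos (1 * Real.pi / 16) ∧
      Real.cos (1 * Real.pi / 16) ≤ 0.98078528041 := by
    rw [one_mul, Real.cos_pi_div_sixteen]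
    constructor <;> linarith [s3.1, s3.2]
  have c2 : 0.92387953251 ≤ Real.cos (2 * Real.pi / 16) ∧
      Real.cos (2 * Real.pi / 16) ≤ 0.92387953252 := by
    rw [show 2 * Real.pi / 16 = Real.pi / 8 by ring, Real.cos_pi_div_eight]
    constructor <;> linarith [s2.1, s2.2]
  have c4 : 0.70710678118 ≤ Real.cos (4 * Real.pi / 16) ∧
      Real.cos (4 * Real.pi / 16) ≤ 0.70710678119 := by
    rw [show 4 * Real.pi / 16 = Real.pi / 4 by ring, Real.cos_pi_div_four]
    constructor <;> linarith [s1.1, s1.2]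
  -- The remaining cosines follow from those of `π / 16`, `π / 8` and `π / 4`, which are nested
  -- square roots, by product formulas.
  have p3 := hprod 2 1
  have p5 := hprod 4 1
  have p6 := hprod 4 2
  have p7 := hprod 6 1
  norm_num only at p3 p5 p6 p7
  rw [one_mul] at *
  have m3 := mul_interval (by norm_num) (by norm_num) c2 c1
  have m5 := mul_interval (by norm_num) (by norm_num) c4 c1
  have m6 := mul_interval (by norm_num) (by norm_num) c4 c2
  have c3 : 0.8314696122 ≤ Real.cos (3 * Real.pi / 16) ∧
      Real.cos (3 * Real.pi / 16) ≤ 0.8314696124 := by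
    rw [p3]
    constructor <;> linarith [m3.1, m3.2, c1.1, c1.2]
  have c5 : 0.5555702329 ≤ Real.cos (5 * Real.pi / 16) ∧
      Real.cos (5 * Real.pi / 16) ≤ 0.5555702332 := by
    rw [p5]
    constructor <;> linarith [m5.1, m5.2, c3.1, c3.2]
  have c6 : 0.3826834323 ≤ Real.cos (6 * Real.pi / 16) ∧
      Real.cos (6 * Real.pi / 16) ≤ 0.3826834325 := by
    rw [p6]
    constructor <;> linarith [m6.1, m6.2, c2.1, c2.2]
  have m7 := mul_interval (by norm_num) (by norm_num) c6 c1
  refine ⟨c1, c2, c3, c4, c5, c6, ?_⟩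
  rw [p7]
  constructor <;> linarith [m7.1, m7.2, c5.1, c5.2]

/-- This is where the inequality is seen to be the right one: the ray from noise to the noiseless
correlations leaves the local set through the simplex of the eight vertices. -/
theorem vertexWeight_cosProfile_nonneg (i : Fin 8) : 0 ≤ vertexWeight cosProfile i := by
  obtain ⟨c1, c2, c3, c4, c5, c6, c7⟩ := cos_mul_pi_div_sixteen_bounds
  fin_cases i <;>
    simp only [vertexWeight, Fin.sum_univ_eight, weightTable, Fin.zero_eta, Fin.mk_one,
      Fin.reduceFinMk, Matrix.cons_val, cosProfile_natCast] <;>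
    simp only [Fin.isValue, Fin.val_zero, Fin.val_one, Fin.val_two,
      show ((3 : Fin 8) : ℕ) = 3 from rfl, show ((4 : Fin 8) : ℕ) = 4 from rfl,
      show ((5 : Fin 8) : ℕ) = 5 from rfl, show ((6 : Fin 8) : ℕ) = 6 from rfl,
      show ((7 : Fin 8) : ℕ) = 7 from rfl, Nat.cast_zero, Nat.cast_one, Nat.cast_ofNat, zero_mul,
      zero_div, Real.cos_zero] <;>
    linarith [c1.1, c1.2, c2.1, c2.2, c3.1, c3.2, c4.1, c4.2, c5.1, c5.2, c6.1, c6.2, c7.1, c7.2]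

theorem polygonValue_eq_cos : polygonValue = 1 / 2 +
    11960704 / 9508049 * Real.cos (1 * Real.pi / 16) - 120 / 137 * Real.cos (2 * Real.pi / 16) +
    15419776 / 9508049 * Real.cos (3 * Real.pi / 16) + 2 / 3 * Real.cos (4 * Real.pi / 16) -
    5453760 / 9508049 * Real.cos (5 * Real.pi / 16) - 56 / 137 * Real.cos (6 * Real.pi / 16) -
    11459008 / 9508049 * Real.cos (7 * Real.pi / 16) := by
  simp only [polygonValue, vertexWeight, Fin.sum_univ_eight, weightTable, Matrix.cons_val,
    cosProfile_natCast]
  simp only [Fin.isValue, Fin.val_zero, Fin.val_one, Fin.val_two,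
    show ((3 : Fin 8) : ℕ) = 3 from rfl, show ((4 : Fin 8) : ℕ) = 4 from rfl,
    show ((5 : Fin 8) : ℕ) = 5 from rfl, show ((6 : Fin 8) : ℕ) = 6 from rfl,
    show ((7 : Fin 8) : ℕ) = 7 from rfl, Nat.cast_zero, Nat.cast_one, Nat.cast_ofNat, zero_mul,
    zero_div, Real.cos_zero]
  ring

theorem polygonValue_eq : polygonValue = 1 / 2 + Real.sqrt 2 / 3
    - (120 * Real.cos (Real.pi / 8) + 56 * Real.sin (Real.pi / 8)) / 137
    + (11960704 * Real.cos (Real.pi / 16) - 11459008 * Real.sin (Real.pi / 16)) / 9508049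
    + (15419776 * Real.cos (3 * Real.pi / 16) - 5453760 * Real.sin (3 * Real.pi / 16))
        / 9508049 := by
  rw [polygonValue_eq_cos, show 2 * Real.pi / 16 = Real.pi / 8 by ring,
    show 4 * Real.pi / 16 = Real.pi / 4 by ring, Real.cos_pi_div_four, one_mul,
    show 5 * Real.pi / 16 = Real.pi / 2 - 3 * Real.pi / 16 by ring,
    show 6 * Real.pi / 16 = Real.pi / 2 - Real.pi / 8 by ring,
    show 7 * Real.pi / 16 = Real.pi / 2 - Real.pi / 16 by ring, Real.cos_pi_div_two_sub,
    Real.cos_pi_div_two_sub, Real.cos_pi_div_two_sub]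
  ring

theorem polygonValue_bounds : 2.034177 ≤ polygonValue ∧ polygonValue ≤ 2.034178 := by
  obtain ⟨c1, c2, c3, c4, c5, c6, c7⟩ := cos_mul_pi_div_sixteen_bounds
  rw [polygonValue_eq_cos]
  constructor <;>
    linarith [c1.1, c1.2, c2.1, c2.2, c3.1, c3.2, c4.1, c4.2, c5.1, c5.2, c6.1, c6.2, c7.1, c7.2]

theorem polygonTensor_mem {v : ℝ} (hv : 0 ≤ v) (h : v * polygonValue ≤ 1) :
    polygonTensor 16 v ∈ localPolytope 16 := by
  have hs : ∑ i, v * vertexWeight cosProfile i = v * polygonValue := (Finset.mul_sum _ _ _).symm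
  have hmem := (convex_convexHull ℝ {d | ∃ a b c : Fin 16 → ℤˣ, d = detStrategy a b c}).sum_mem
    (t := (Finset.univ : Finset (Option (Fin 8))))
    (w := fun o => o.elim (1 - v * polygonValue) fun i => v * vertexWeight cosProfile i)
    (z := fun o => o.elim (symTensor 0) fun i => symTensor (vertexProfile i))
    (fun o _ => by
      cases o with
      | none => exact sub_nonneg.2 h
      | some i => exact mul_nonneg hv (vertexWeight_cosProfile_nonneg i))
    (by simp [Fintype.sum_option, hs])
    (fun o _ => by
      cases o with
      | none => exact symTensor_zero_mem
      | some i => exact symTensor_vertexProfile_mem i)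
  refine (congrArg (· ∈ localPolytope 16) ?_).mpr hmem
  rw [polygonTensor_eq, symTensor_eq_noise_add (isEvenAnti_mul v), Fintype.sum_option]
  simp only [vertexWeight_mul, Option.elim, smul_sub, Finset.sum_sub_distrib, ← Finset.sum_smul, hs]
  module

theorem polygonTensor_mem_iff {v : ℝ} (hv : 0 ≤ v) :
    polygonTensor 16 v ∈ localPolytope 16 ↔ v * polygonValue ≤ 1 := by
  refine ⟨fun h => ?_, polygonTensor_mem hv⟩
  rw [← bellValue_polygonTensor]
  exact bellValue_ghzBell_le h

theorem polygonThreshold_eq : polygonThreshold 16 = polygonValue⁻¹ := by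
  have hb := polygonValue_bounds.1
  have hpos : 0 < polygonValue := by linarith
  refine IsGreatest.csSup_eq ⟨⟨by positivity, inv_le_one_of_one_le₀ (by linarith),
    polygonTensor_mem (by positivity) (inv_mul_cancel₀ hpos.ne').le⟩, ?_⟩
  rintro v ⟨hv, -, h⟩
  rw [polygonTensor_mem_iff hv, ← le_div_iff₀ hpos] at h
  rwa [← one_div]

end GHZBell

theorem mainTheorem6 :
    -- the closed form of the threshold for 16 planar measurements per party
    GHZBell.polygonThreshold 16 =
      (1 / 2 + Real.sqrt 2 / 3
        - (120 * Real.cos (Real.pi / 8) + 56 * Real.sin (Real.pi / 8)) / 137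
        + (11960704 * Real.cos (Real.pi / 16) - 11459008 * Real.sin (Real.pi / 16)) / 9508049
        + (15419776 * Real.cos (3 * Real.pi / 16) - 5453760 * Real.sin (3 * Real.pi / 16))
            / 9508049)⁻¹ ∧
    |GHZBell.polygonThreshold 16 - 0.49160| < 0.000005 ∧
    -- the threshold is exact
    (∀ v : ℝ, 0 ≤ v → v ≤ 1 →
      (GHZBell.polygonTensor 16 v ∈ GHZBell.localPolytope 16 ↔
        v ≤ GHZBell.polygonThreshold 16)) ∧
    -- the explicit Bell inequality, its local bound, its quantum value, and its facet
    GHZBell.IsLocalBound GHZBell.ghzBell 1 ∧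
    GHZBell.bellValue GHZBell.ghzBell (GHZBell.polygonTensor 16 1) =
      (GHZBell.polygonThreshold 16)⁻¹ ∧
    GHZBell.IsFacet (GHZBell.symmetrizedLocalPolytope 16) GHZBell.ghzBell 1 ∧
    -- a facet of the local polytope itself that attains the same threshold
    (∃ M : GHZBell.Tensor 16, M none none none = 0 ∧
      GHZBell.IsLocalBound M 1 ∧
      GHZBell.IsFacet (GHZBell.localPolytope 16) M 1 ∧
      GHZBell.bellValue M (GHZBell.polygonTensor 16 1) = (GHZBell.polygonThreshold 16)⁻¹ ∧
      ∀ r ∈ GHZBell.symmetrizedLocalPolytope 16,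
        GHZBell.bellValue M r = GHZBell.bellValue GHZBell.ghzBell r) ∧
    -- the bound on the threshold under all projective measurements
    GHZBell.ghzThreshold ≤ GHZBell.polygonThreshold 16 := by
  open GHZBell in
  have hb := polygonValue_bounds
  have hpos : 0 < polygonValue := by linarith
  have hiff : ∀ v : ℝ, 0 ≤ v → (polygonTensor 16 v ∈ localPolytope 16 ↔
      v ≤ polygonThreshold 16) := fun v hv => by
    rw [polygonTensor_mem_iff hv, polygonThreshold_eq, ← one_div, le_div_iff₀ hpos]
  have hval : bellValue ghzBell (polygonTensor 16 1) = (polygonThreshold 16)⁻¹ := by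
    rw [bellValue_polygonTensor, polygonThreshold_eq, inv_inv, one_mul]
  obtain ⟨M, hM0, hMb, hMf, hMs⟩ := exists_facet_localPolytope
  refine ⟨by rw [polygonThreshold_eq, polygonValue_eq], ?_, fun v hv _ => hiff v hv,
    isLocalBound_ghzBell, hval, isFacet_symmetrized, ⟨M, hM0, hMb, hMf, ?_, ?_⟩, ?_⟩
  · have h1 : polygonValue⁻¹ * polygonValue = 1 := inv_mul_cancel₀ hpos.ne'
    have h2 : 0 < polygonValue⁻¹ := inv_pos.2 hpos
    rw [polygonThreshold_eq, abs_lt]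
    constructor <;> nlinarith [hb.1, hb.2]
  · rw [← hval, polygonTensor_eq, hMs _ (isEvenAnti_mul 1)]
  · intro r hr
    obtain ⟨g, hg, rfl⟩ := exists_eq_symTensor (localPolytope_none hr.1) hr.2
    exact hMs g hg
  -- `Real.sSup_le` also asks for a nonnegative bound, since the supremum of the empty set is 0 by
  -- convention. The polygon observables are one admissible choice of measurements, so locality
  -- under all of them implies the threshold.
  · refine Real.sSup_le ?_ (by rw [polygonThreshold_eq]; positivity)
    rintro v ⟨hv, -, hloc⟩
    exact (hiff v hv).1 (hloc 16 _ _ _ (isObservable_polygonObservable 16)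
      (isObservable_polygonObservable 16) (isObservable_polygonObservable 16))
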